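/- Let $\mathcal L=\mathbb Z v_1\oplus\mathbb Z v_2$ be a lattice in $\mathbb R^2$ with a fundamental domain $\Omega$ of area $1$. Let $\mathcal A$ be the set of all pairs $(u,\mathbf a)$ such that - $u\in H^1_{\mathrm{loc}}(\mathbb R^2;\mathbb C)$ and, for both generators $v=(v_x,v_y)\in\{v_1,v_2\}$ and almost every $(x,y)\in\mathbb R^2$, $u((x,y)+v)=e^{i\pi(v_xy-v_yx)}u(x,y)$; - $\mathbf a=(a_x,a_y)\in H^1_{\mathrm{loc}}(\mathbb R^2;\mathbb R^2)$ is $\mathcal L$-periodic, $\operatorname{div}\mathbf a=0$ and $\int_\Omega\mathbf a=0$. Elements of $H^1_{\mathrm{loc}}$ are identified when they are equal almost everywhere, and derivatives are weak derivatives. For $k>0$ and $H_{\mathrm{int}}>0$ put $\mu=\frac{H_{\mathrm{int}}}{2\pi k}$, $\mathbf A_0(x,y)=\pi(-y,x)$, $\operatorname{curl}\mathbf a=\partial_xa_y-\partial_ya_x$, $$E_{k,H_{\mathrm{int}}}(u,\mathbf a)=\int_\Omega \frac{\mu}{2}\,\bigl\Vert i\nabla u+(\mathbf A_0+\mathbf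 a)u\bigr\Vert^2+\frac14\,(1-|u|^2)^2+\frac{\mu^2k^2}{2}\,|\operatorname{curl}\mathbf a|^2 ,$$ and let $m_E(k,H_{\mathrm{int}})=\inf_{(u,\mathbf a)\in\mathcal A}E_{k,H_{\mathrm{int}}}(u,\mathbf a)$. Theorem. If $k\ge\frac1{\sqrt2}$ and $H_{\mathrm{int}}\ge k$, then $m_E(k,H_{\mathrm{int}})=\frac14$. Furthermore, the infimum is attained, and it is attained only by the pair $(u,\mathbf a)=(0,0)$. -/

import Mathlib

open MeasureTheory
open scoped ContDiff

noncomputable section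

namespace GinzburgLandau

/-- The Euclidean plane with its Lebesgue measure; a point is `z = (x, y) = (z.1, z.2)`. -/
abbrev Plane : Type := ℝ × ℝ

section Sobolev

variable {F : Type*} [NormedAddCommGroup F] [NormedSpace ℝ F]

/-- `f` belongs to `L²_loc(ℝ²)`. -/
def L2Loc (f : Plane → F) : Prop :=
  ∀ K : Set Plane, IsCompact K → MemLp f 2 (volume.restrict K)

/-- `g` is the weak (distributional) derivative of `f` on `ℝ²` in the direction `e`:
`∫ (∂ₑφ) f = - ∫ φ g` for every smooth compactly supported `φ`. -/
def HasWeakDeriv (e : Plane) (f g : Plane → F) : Prop :=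
  LocallyIntegrable f ∧ LocallyIntegrable g ∧
    ∀ φ : Plane → ℝ, ContDiff ℝ ∞ φ → HasCompactSupport φ →
      ∫ z, (fderiv ℝ φ z e) • f z = - ∫ z, φ z • g z

/-- Weak derivatives are unique up to equality almost everywhere. -/
theorem HasWeakDeriv.ae_eq [CompleteSpace F] {e : Plane} {f g h : Plane → F}
    (hg : HasWeakDeriv e f g) (hh : HasWeakDeriv e f h) : g =ᵐ[volume] h := by
  refine ae_eq_of_integral_contDiff_smul_eq hg.2.1 hh.2.1 fun φ hφ hc => ?_
  exact neg_injective ((hg.2.2 φ hφ hc).symm.trans (hh.2.2 φ hφ hc))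

open Classical in
/-- The weak derivative of `f` in the direction `e` (a representative of it, and `0` if there is
none). -/
def weakDeriv (e : Plane) (f : Plane → F) : Plane → F :=
  if h : ∃ g, HasWeakDeriv e f g then h.choose else 0

theorem HasWeakDeriv.weakDeriv_ae_eq [CompleteSpace F] {e : Plane} {f g : Plane → F}
    (hg : HasWeakDeriv e f g) : weakDeriv e f =ᵐ[volume] g := by
  have h : ∃ g, HasWeakDeriv e f g := ⟨g, hg⟩
  rw [weakDeriv, dif_pos h]
  exact h.choose_spec.ae_eq hg

/-- The weak partial derivative `∂f/∂x`. -/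
def dx (f : Plane → F) : Plane → F := weakDeriv (1, 0) f

/-- The weak partial derivative `∂f/∂y`. -/
def dy (f : Plane → F) : Plane → F := weakDeriv (0, 1) f

/-- `f` belongs to `H¹_loc(ℝ²)`: it is in `L²_loc` and has weak partial derivatives in `L²_loc`. -/
def H1Loc (f : Plane → F) : Prop :=
  L2Loc f ∧ (∃ g, L2Loc g ∧ HasWeakDeriv (1, 0) f g) ∧ (∃ g, L2Loc g ∧ HasWeakDeriv (0, 1) f g)

end Sobolev

/-- `div a = ∂a_x/∂x + ∂a_y/∂y`, in the weak sense. -/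
def div (a : Plane → Plane) (z : Plane) : ℝ :=
  dx (fun w => (a w).1) z + dy (fun w => (a w).2) z

/-- `curl a = ∂a_y/∂x - ∂a_x/∂y`, in the weak sense. -/
def curl (a : Plane → Plane) (z : Plane) : ℝ :=
  dx (fun w => (a w).2) z - dy (fun w => (a w).1) z

/-- `u` is an `H¹_loc` section of the line bundle `E₁` over `ℝ²/L` (trivialised by the basis `b`):
`u (z + v) = exp (iπ (v_x y - v_y x)) u z` for almost every `z = (x, y)`, for the two generators
`v` of `L`.  The relation for the generators determines it for all lattice vectors: if `L` has
covolume one, then for `v = m v₁ + n v₂` the factor is `(-1)^(m n) exp (iπ (v_x y - v_y x))`. -/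
def IsSection {L : Submodule ℤ Plane} (b : Module.Basis (Fin 2) ℤ L) (u : Plane → ℂ) : Prop :=
  H1Loc u ∧ ∀ j : Fin 2, ∀ᵐ z : Plane,
    u (z + (b j : Plane)) =
      Complex.exp (Complex.I * Real.pi *
        (((b j : Plane).1 * z.2 - (b j : Plane).2 * z.1 : ℝ) : ℂ)) * u z

/-- `a` is an admissible vector potential: an `L`-periodic, divergence free `H¹_loc` vector field
with vanishing mean over the fundamental domain `Ω`. -/
def IsPotential (L : Submodule ℤ Plane) (Ω : Set Plane) (a : Plane → Plane) : Prop :=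
  H1Loc (fun z => (a z).1) ∧ H1Loc (fun z => (a z).2) ∧
    (∀ᵐ z : Plane, div a z = 0) ∧
    (∀ v ∈ L, ∀ᵐ z : Plane, a (z + v) = a z) ∧
    (∫ z in Ω, (a z).1 = 0) ∧ (∫ z in Ω, (a z).2 = 0)

/-- The space of all admissible pairs `(u, a)`. -/
def admissible {L : Submodule ℤ Plane} (b : Module.Basis (Fin 2) ℤ L) (Ω : Set Plane) :
    Set ((Plane → ℂ) × (Plane → Plane)) :=
  {p | IsSection b p.1 ∧ IsPotential L Ω p.2}

/-- The background potential `A₀ (x, y) = π (-y, x)`. -/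
def A0 (z : Plane) : Plane := (-(Real.pi * z.2), Real.pi * z.1)

/-- The parameter `μ = H_int / (2 π k)`. -/
def mu (k Hint : ℝ) : ℝ := Hint / (2 * Real.pi * k)

/-- The squared norm `‖i ∇u + (A₀ + a) u‖²` at the point `z`. -/
def covGradSq (u : Plane → ℂ) (a : Plane → Plane) (z : Plane) : ℝ :=
  ‖Complex.I * dx u z + (((A0 z).1 + (a z).1 : ℝ) : ℂ) * u z‖ ^ 2 +
    ‖Complex.I * dy u z + (((A0 z).2 + (a z).2 : ℝ) : ℂ) * u z‖ ^ 2

/-- The (nonnegative) energy density. -/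
def density (k Hint : ℝ) (u : Plane → ℂ) (a : Plane → Plane) (z : Plane) : ℝ :=
  mu k Hint / 2 * covGradSq u a z + 1 / 4 * (1 - ‖u z‖ ^ 2) ^ 2 +
    mu k Hint ^ 2 * k ^ 2 / 2 * |curl a z| ^ 2

/-- The energy `E_{k, H_int} (u, a)`: the Lebesgue integral over `Ω` of the nonnegative density. -/
def energy (Ω : Set Plane) (k Hint : ℝ) (u : Plane → ℂ) (a : Plane → Plane) : ENNReal :=
  ∫⁻ z in Ω, ENNReal.ofReal (density k Hint u a z)

/-- The infimum `m_E (k, H_int)` of the energy over all admissible pairs. -/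
def mE {L : Submodule ℤ Plane} (b : Module.Basis (Fin 2) ℤ L) (Ω : Set Plane) (k Hint : ℝ) :
    ENNReal :=
  ⨅ p ∈ admissible b Ω, energy Ω k Hint p.1 p.2

end GinzburgLandau

end

/-!
# The normal state minimises the Ginzburg-Landau energy above the critical field

Write `D = i∇ + A₀ + a` for the covariant derivative, `X = Dₓ u`, `Y = D_y u`, `h = curl a`, so that
the magnetic field is `B = 2π + h`. The key fact is an integral identity on the torus,
`∫_Ω 2 Im (conj X * Y) = ∫_Ω B |u|²` (`setIntegral_bogomolny_eq_zero`): the difference of the two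
integrands is the divergence of a periodic vector field. Since `2 Im (conj X * Y) ≤ |X|² + |Y|²`,
this is the Bogomolny bound `∫_Ω |D u|² ≥ ∫_Ω (2π + h) |u|²`. Inserting it in the energy, with
`N = |u|²`, gives
`E - 1/4 ≥ ∫_Ω (πμ - 1/2) N + (N² / 4 + μ N h / 2 + μ² k² h² / 2) ≥ 1/4 ∫_Ω (N + μ h)²`,
where `πμ ≥ 1/2` is the condition on `H_int` and `k² ≥ 1/2` that on `k`
(`ofReal_quarter_add_le_energy`). If `E = 1/4`, then `N = -μ h` almost everywhere; but `h` has mean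
zero, so `N = 0`, hence `u = 0` and `h = 0`. Finally a periodic field of mean zero with vanishing
divergence and curl is zero (`IsPotential.ae_eq_zero`), which follows from the same identity, applied
to `a_x + i a_y` without a gauge field.

The identity has to be proved for `u` and `a` merely in `H¹_loc`. For smooth `u` its weak form on the
plane needs nothing but the definition of the weak derivatives of `a`, tested with `φ |u|²`. The
general case follows by mollifying `u`: all terms are continuous for convergence in `L⁴_loc` with
derivatives in `L²_loc`, because `a` is in `L⁴_loc` as well. The convergence in `L⁴_loc` comes from
the Gagliardo-Nirenberg-Sobolev inequality (`H1Loc.exists_smooth_approx`). The passage from the plane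
to the torus consists in averaging over the translates of a test function
(`setIntegral_eq_zero_of_weak_div`).

The real inner product on `ℂ` is used throughout: `Im (conj X * Y) = ⟪i X, Y⟫`.
-/

open Filter Topology Set
open scoped ENNReal NNReal

noncomputable section

namespace GinzburgLandau

section

variable {F G : Type*} [NormedAddCommGroup F] [NormedAddCommGroup G]

/-! ### Locally square integrable functions -/

theorem L2Loc.congr {f g : Plane → F} (hf : L2Loc f) (h : f =ᵐ[volume] g) : L2Loc g :=
  fun K hK => (memLp_congr_ae (ae_restrict_of_ae h)).1 (hf K hK)

theorem L2Loc.locallyIntegrable {f : Plane → F} (hf : L2Loc f) : LocallyIntegrable f :=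
  locallyIntegrable_iff.2 fun K hK => by
    have : IsFiniteMeasure (volume.restrict K) := ⟨by simpa using hK.measure_lt_top⟩
    exact (hf K hK).integrable one_le_two

theorem L2Loc.add {f g : Plane → F} (hf : L2Loc f) (hg : L2Loc g) :
    L2Loc fun z => f z + g z :=
  fun K hK => (hf K hK).add (hg K hK)

theorem L2Loc.of_continuous {f : Plane → F} [SecondCountableTopology F] (hf : Continuous f) :
    L2Loc f := fun K hK => by
  have : IsFiniteMeasure (volume.restrict K) := ⟨by simpa using hK.measure_lt_top⟩
  obtain ⟨C, hC⟩ := hK.exists_bound_of_continuousOn hf.continuousOn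
  exact MemLp.of_bound hf.aestronglyMeasurable C
    ((ae_restrict_iff' hK.measurableSet).2 (Eventually.of_forall hC))

variable [NormedSpace ℝ F] [NormedSpace ℝ G]

theorem L2Loc.clm {f : Plane → F} (hf : L2Loc f) (T : F →L[ℝ] G) : L2Loc fun z => T (f z) :=
  fun K hK => T.comp_memLp' (hf K hK)

theorem L2Loc.smul {f : Plane → F} (hf : L2Loc f) {η : Plane → ℝ} (hη : Continuous η) :
    L2Loc fun z => η z • f z := fun K hK => by
  obtain ⟨C, hC⟩ := hK.exists_bound_of_continuousOn hη.continuousOn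
  refine (hf K hK).of_le_mul (c := C)
    (hη.aestronglyMeasurable.smul (hf K hK).1) ?_
  refine (ae_restrict_iff' hK.measurableSet).2 (Eventually.of_forall fun z hz => ?_)
  rw [norm_smul]
  exact mul_le_mul_of_nonneg_right (hC z hz) (norm_nonneg _)

/-! ### Weak derivatives -/

theorem integrable_smul_of_testFunction {f : Plane → F} (hf : LocallyIntegrable f)
    {φ : Plane → ℝ} (hφ : Continuous φ) (hc : HasCompactSupport φ) :
    Integrable fun z => φ z • f z :=
  hf.integrable_smul_left_of_hasCompactSupport hφ hc

theorem contDiff_fderiv_apply {f : Plane → F} (hf : ContDiff ℝ ∞ f) (e : Plane) :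
    ContDiff ℝ ∞ fun z => fderiv ℝ f z e :=
  (hf.fderiv_right (m := ∞) (by simp)).clm_apply contDiff_const

theorem hasCompactSupport_fderiv_apply {f : Plane → F} (hf : HasCompactSupport f) (e : Plane) :
    HasCompactSupport fun z => fderiv ℝ f z e :=
  hf.fderiv_apply (𝕜 := ℝ) e

theorem HasWeakDeriv.congr {e : Plane} {f f' g g' : Plane → F} (h : HasWeakDeriv e f g)
    (hf : f =ᵐ[volume] f') (hg : g =ᵐ[volume] g') : HasWeakDeriv e f' g' := by
  refine ⟨h.1.congr hf, h.2.1.congr hg, fun φ hφ hc => ?_⟩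
  have e₁ : ∫ z, fderiv ℝ φ z e • f z = ∫ z, fderiv ℝ φ z e • f' z :=
    integral_congr_ae (hf.mono fun z hz => by simp only [hz])
  have e₂ : ∫ z, φ z • g z = ∫ z, φ z • g' z :=
    integral_congr_ae (hg.mono fun z hz => by simp only [hz])
  rw [← e₁, ← e₂, h.2.2 φ hφ hc]

theorem HasWeakDeriv.add {e : Plane} {f f' g g' : Plane → F} (h : HasWeakDeriv e f g)
    (h' : HasWeakDeriv e f' g') :
    HasWeakDeriv e (fun z => f z + f' z) (fun z => g z + g' z) := by
  refine ⟨h.1.add h'.1, h.2.1.add h'.2.1, fun φ hφ hc => ?_⟩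
  have hφe := contDiff_fderiv_apply hφ e
  have hce := hasCompactSupport_fderiv_apply hc e
  simp only [smul_add]
  rw [integral_add (integrable_smul_of_testFunction h.1 hφe.continuous hce)
      (integrable_smul_of_testFunction h'.1 hφe.continuous hce),
    integral_add (integrable_smul_of_testFunction h.2.1 hφ.continuous hc)
      (integrable_smul_of_testFunction h'.2.1 hφ.continuous hc),
    h.2.2 φ hφ hc, h'.2.2 φ hφ hc, neg_add]

theorem _root_.MeasureTheory.LocallyIntegrable.clm {f : Plane → F} (hf : LocallyIntegrable f)
    (T : F →L[ℝ] G) : LocallyIntegrable fun z => T (f z) :=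
  locallyIntegrable_iff.2 fun _ hK => T.integrable_comp (locallyIntegrable_iff.1 hf _ hK)

theorem HasWeakDeriv.clm [CompleteSpace F] [CompleteSpace G] {e : Plane} {f g : Plane → F}
    (h : HasWeakDeriv e f g) (T : F →L[ℝ] G) :
    HasWeakDeriv e (fun z => T (f z)) (fun z => T (g z)) := by
  refine ⟨h.1.clm T, h.2.1.clm T, fun φ hφ hc => ?_⟩
  have hφe := contDiff_fderiv_apply hφ e
  have hce := hasCompactSupport_fderiv_apply hc e
  simp only [← T.map_smul]
  rw [T.integral_comp_comm (integrable_smul_of_testFunction h.1 hφe.continuous hce),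
    T.integral_comp_comm (integrable_smul_of_testFunction h.2.1 hφ.continuous hc),
    h.2.2 φ hφ hc, map_neg]

/-- Smooth functions are weakly differentiable, with their classical derivatives. -/
theorem hasWeakDeriv_of_contDiff (e : Plane) {f : Plane → F} (hf : ContDiff ℝ ∞ f) :
    HasWeakDeriv e f (fun z => fderiv ℝ f z e) := by
  have hfe := contDiff_fderiv_apply hf e
  refine ⟨hf.continuous.locallyIntegrable, hfe.continuous.locallyIntegrable, fun φ hφ hc => ?_⟩
  have hφe := contDiff_fderiv_apply hφ e
  have hce := hasCompactSupport_fderiv_apply hc e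
  rw [integral_smul_fderiv_eq_neg_fderiv_smul_of_integrable, neg_neg]
  · exact integrable_smul_of_testFunction hf.continuous.locallyIntegrable hφe.continuous hce
  · exact integrable_smul_of_testFunction hfe.continuous.locallyIntegrable hφ.continuous hc
  · exact integrable_smul_of_testFunction hf.continuous.locallyIntegrable hφ.continuous hc
  · exact fun z _ => (hφ.differentiable (by simp)) z
  · exact fun z _ => (hf.differentiable (by simp)) z

theorem integral_fderiv_eq_zero {φ : Plane → ℝ} (hφ : ContDiff ℝ ∞ φ) (hc : HasCompactSupport φ)
    (e : Plane) : ∫ z, fderiv ℝ φ z e = 0 := by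
  simpa using (hasWeakDeriv_of_contDiff e (contDiff_const (c := (1 : ℝ)))).2.2 φ hφ hc

/-- Leibniz rule for the product with a smooth function. -/
theorem HasWeakDeriv.smul {e : Plane} {f g : Plane → F} (h : HasWeakDeriv e f g)
    {η : Plane → ℝ} (hη : ContDiff ℝ ∞ η) :
    HasWeakDeriv e (fun z => η z • f z) (fun z => η z • g z + fderiv ℝ η z e • f z) := by
  have hηe := contDiff_fderiv_apply hη e
  have l1 : LocallyIntegrable fun z => η z • f z := by
    simpa using h.1.continuous_smul hη.continuous
  have l2 : LocallyIntegrable fun z => η z • g z := by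
    simpa using h.2.1.continuous_smul hη.continuous
  have l3 : LocallyIntegrable fun z => fderiv ℝ η z e • f z := by
    simpa using h.1.continuous_smul hηe.continuous
  refine ⟨l1, l2.add l3, fun φ hφ hc => ?_⟩
  have hφe := contDiff_fderiv_apply hφ e
  have hce := hasCompactSupport_fderiv_apply hc e
  have key := h.2.2 (fun z => φ z * η z) (hφ.mul hη) hc.mul_right
  have hd : ∀ z, fderiv ℝ (fun z => φ z * η z) z e
      = φ z * fderiv ℝ η z e + η z * fderiv ℝ φ z e := fun z => by
    rw [fderiv_fun_mul ((hφ.differentiable (by simp)) z) ((hη.differentiable (by simp)) z)]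
    simp
  have i1 := integrable_smul_of_testFunction l1 hφe.continuous hce
  have i2 := integrable_smul_of_testFunction l2 hφ.continuous hc
  have i3 := integrable_smul_of_testFunction l3 hφ.continuous hc
  have e1 : ∫ z, fderiv ℝ (fun z => φ z * η z) z e • f z
      = (∫ z, φ z • fderiv ℝ η z e • f z) + ∫ z, fderiv ℝ φ z e • η z • f z := by
    rw [← integral_add i3 i1]
    congr 1; ext z
    rw [hd, add_smul, mul_smul, mul_comm (η z), mul_smul]
  rw [e1] at key
  simp only [smul_add]
  rw [integral_add i2 i3]
  simp only [mul_smul] at key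
  rw [neg_add, ← key]
  abel

theorem HasWeakDeriv.translate {e : Plane} {f g : Plane → F} (h : HasWeakDeriv e f g)
    (v : Plane) : HasWeakDeriv e (fun z => f (z + v)) (fun z => g (z + v)) := by
  have lt : ∀ {q : Plane → F}, LocallyIntegrable q → LocallyIntegrable fun z => q (z + v) := by
    intro q hq
    refine locallyIntegrable_iff.2 fun K hK => ?_
    have := (locallyIntegrable_iff.1 hq) _ (hK.image (continuous_add_const v))
    have mp : MeasurePreserving (fun z : Plane => z + v) volume volume :=
      measurePreserving_add_right volume v
    exact (mp.integrableOn_image (MeasurableEquiv.addRight v).measurableEmbedding).1 this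
  refine ⟨lt h.1, lt h.2.1, fun φ hφ hc => ?_⟩
  have key := h.2.2 (fun z => φ (z - v)) (hφ.comp (contDiff_id.sub contDiff_const))
    (hc.comp_homeomorph (Homeomorph.subRight v))
  have hd : ∀ z, fderiv ℝ (fun z => φ (z - v)) z = fderiv ℝ φ (z - v) := fun z => by
    rw [fderiv_comp_sub]
  rw [← integral_add_right_eq_self _ v, ← integral_add_right_eq_self (fun z => φ (z - v) • g z) v]
    at key
  simpa [hd] using key

/-! ### Functions in `H¹_loc` -/

theorem h1Loc_of_contDiff [SecondCountableTopology F] {f : Plane → F}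
    (hf : ContDiff ℝ ∞ f) : H1Loc f :=
  ⟨L2Loc.of_continuous hf.continuous,
    ⟨_, L2Loc.of_continuous (contDiff_fderiv_apply hf _).continuous,
      hasWeakDeriv_of_contDiff _ hf⟩,
    ⟨_, L2Loc.of_continuous (contDiff_fderiv_apply hf _).continuous,
      hasWeakDeriv_of_contDiff _ hf⟩⟩

section

variable [CompleteSpace F] [CompleteSpace G] {f : Plane → F}

theorem HasWeakDeriv.dx_ae_eq {g : Plane → F} (h : HasWeakDeriv (1, 0) f g) :
    dx f =ᵐ[volume] g := h.weakDeriv_ae_eq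

theorem HasWeakDeriv.dy_ae_eq {g : Plane → F} (h : HasWeakDeriv (0, 1) f g) :
    dy f =ᵐ[volume] g := h.weakDeriv_ae_eq

theorem H1Loc.hasWeakDeriv_dx (h : H1Loc f) : HasWeakDeriv (1, 0) f (dx f) := by
  obtain ⟨-, ⟨g, -, hg⟩, -⟩ := h
  exact hg.congr EventuallyEq.rfl hg.dx_ae_eq.symm

theorem H1Loc.hasWeakDeriv_dy (h : H1Loc f) : HasWeakDeriv (0, 1) f (dy f) := by
  obtain ⟨-, -, ⟨g, -, hg⟩⟩ := h
  exact hg.congr EventuallyEq.rfl hg.dy_ae_eq.symm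

theorem H1Loc.l2Loc_dx (h : H1Loc f) : L2Loc (dx f) := by
  obtain ⟨-, ⟨g, hg', hg⟩, -⟩ := h
  exact hg'.congr hg.dx_ae_eq.symm

theorem H1Loc.l2Loc_dy (h : H1Loc f) : L2Loc (dy f) := by
  obtain ⟨-, -, ⟨g, hg', hg⟩⟩ := h
  exact hg'.congr hg.dy_ae_eq.symm

theorem H1Loc.add {g : Plane → F} (hf : H1Loc f) (hg : H1Loc g) : H1Loc fun z => f z + g z :=
  ⟨hf.1.add hg.1, ⟨_, hf.l2Loc_dx.add hg.l2Loc_dx, hf.hasWeakDeriv_dx.add hg.hasWeakDeriv_dx⟩,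
    ⟨_, hf.l2Loc_dy.add hg.l2Loc_dy, hf.hasWeakDeriv_dy.add hg.hasWeakDeriv_dy⟩⟩

theorem H1Loc.clm (hf : H1Loc f) (T : F →L[ℝ] G) : H1Loc fun z => T (f z) :=
  ⟨hf.1.clm T, ⟨_, hf.l2Loc_dx.clm T, hf.hasWeakDeriv_dx.clm T⟩,
    ⟨_, hf.l2Loc_dy.clm T, hf.hasWeakDeriv_dy.clm T⟩⟩

end

end

section

open scoped Convolution

variable {F : Type*} [NormedAddCommGroup F]

/-! ### Mollification in `L²` -/

/-- Translations act continuously on `L²`. -/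
theorem tendsto_eLpNorm_sub_translate {f : Plane → F} (hf : MemLp f 2) :
    Tendsto (fun h : Plane => eLpNorm (fun z => f (z - h) - f z) 2) (𝓝 0) (𝓝 0) := by
  have : Fact ((1 : ℝ≥0∞) ≤ 2) := ⟨one_le_two⟩
  let T : C(Plane, C(Plane, Plane)) :=
    (ContinuousMap.mk (fun p : Plane × Plane => p.2 - p.1) (by fun_prop)).curry
  have hT : ∀ h, MeasurePreserving (T h) volume volume := fun h =>
    measurePreserving_sub_right volume h
  have key := Filter.Tendsto.compMeasurePreservingLp
    (tendsto_const_nhds (x := hf.toLp f) (f := 𝓝 (0 : Plane))) (T.continuous.tendsto 0) hT (hT 0)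
    (by simp)
  simp only [Lp.toLp_compMeasurePreserving] at key
  have := (Lp.tendsto_Lp_iff_tendsto_eLpNorm'' _
    (fun h => hf.comp_measurePreserving (hT h)) _ (hf.comp_measurePreserving (hT 0))).1 key
  refine this.congr fun h => eLpNorm_congr_ae (Eventually.of_forall fun z => ?_)
  simp [T]

theorem aestronglyMeasurable_comp_sub {f : Plane → F} (hf : AEStronglyMeasurable f) (z : Plane) :
    AEStronglyMeasurable fun h => f (z - h) :=
  hf.comp_measurePreserving (Measure.measurePreserving_sub_left volume z)

variable [NormedSpace ℝ F]

/-- Jensen's inequality for the square of the norm and the probability density `ρ`. -/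
theorem enorm_integral_smul_rpow_two_le {ρ : Plane → ℝ} (hρ : 0 ≤ ρ) (hρi : Integrable ρ)
    (hρ1 : ∫ z, ρ z = 1) {g : Plane → F} (hg : AEStronglyMeasurable g) :
    ‖∫ h, ρ h • g h‖ₑ ^ (2 : ℝ) ≤ ∫⁻ h, ‖ρ h‖ₑ * ‖g h‖ₑ ^ (2 : ℝ) := by
  have hm : AEMeasurable (fun h => ‖ρ h‖ₑ) := hρi.1.enorm
  have h1 : ∫⁻ h, ‖ρ h‖ₑ = 1 := by
    rw [← ofReal_integral_norm_eq_lintegral_enorm hρi]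
    simp [Real.norm_of_nonneg (hρ _), hρ1]
  have key := ENNReal.lintegral_mul_norm_pow_le hm
    (hm.mul (hg.enorm.pow_const (2 : ℝ))) (p := 1 / 2) (q := 1 / 2)
    (by norm_num) (by norm_num) (by norm_num)
  rw [h1, ENNReal.one_rpow, one_mul] at key
  have hpt : ∀ h, ‖ρ h • g h‖ₑ
      = ‖ρ h‖ₑ ^ (1 / 2 : ℝ) * (‖ρ h‖ₑ * ‖g h‖ₑ ^ (2 : ℝ)) ^ (1 / 2 : ℝ) := fun h => by
    rw [ENNReal.mul_rpow_of_nonneg _ _ (by norm_num), ← ENNReal.rpow_mul, ← mul_assoc,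
      ← ENNReal.rpow_add_of_nonneg _ _ (by norm_num) (by norm_num), enorm_smul]
    norm_num
  calc ‖∫ h, ρ h • g h‖ₑ ^ (2 : ℝ)
      ≤ (∫⁻ h, ‖ρ h • g h‖ₑ) ^ (2 : ℝ) := by
        gcongr; exact enorm_integral_le_lintegral_enorm _
    _ ≤ ((∫⁻ h, ‖ρ h‖ₑ * ‖g h‖ₑ ^ (2 : ℝ)) ^ (1 / 2 : ℝ)) ^ (2 : ℝ) := by
        gcongr
        simp only [hpt]
        exact key
    _ = _ := by rw [← ENNReal.rpow_mul]; norm_num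

/-- A mollification of `f` is at most as far from `f` in `L²` as the translates of `f` by vectors
in the support of the mollifier. -/
theorem eLpNorm_convolution_sub_le [CompleteSpace F] {f : Plane → F} (hf : MemLp f 2)
    (φ : ContDiffBump (0 : Plane)) {δ : ℝ≥0∞}
    (hδ : ∀ h ∈ Metric.ball (0 : Plane) φ.rOut, eLpNorm (fun z => f (z - h) - f z) 2 ≤ δ) :
    eLpNorm (φ.normed volume ⋆[ContinuousLinearMap.lsmul ℝ ℝ] f - f) 2 ≤ δ := by
  set ρ := φ.normed (volume : Measure Plane) with hρ
  have hρc : Continuous ρ := (φ.contDiff_normed (n := 0)).continuous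
  have hρi : Integrable ρ := hρc.integrable_of_hasCompactSupport φ.hasCompactSupport_normed
  have hρ0 : 0 ≤ ρ := fun z => φ.nonneg_normed z
  have hρ1 : ∫ z, ρ z = 1 := φ.integral_normed
  have hfl : LocallyIntegrable f := hf.locallyIntegrable one_le_two
  have hpt : ∀ z, (ρ ⋆[ContinuousLinearMap.lsmul ℝ ℝ] f - f) z
      = ∫ h, ρ h • (f (z - h) - f z) := fun z => by
    have hex : Integrable fun h => ρ h • f (z - h) :=
      φ.hasCompactSupport_normed.convolutionExists_left
        (ContinuousLinearMap.lsmul ℝ ℝ) hρc hfl z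
    simp only [smul_sub]
    rw [integral_sub hex (hρi.smul_const _), integral_smul_const, hρ1, one_smul]
    rfl
  have hjm : AEStronglyMeasurable (fun p : Plane × Plane => f (p.1 - p.2) - f p.1)
      (volume.prod volume) :=
    (hf.1.comp_quasiMeasurePreserving
      (quasiMeasurePreserving_sub_of_right_invariant volume volume)).sub
      (hf.1.comp_quasiMeasurePreserving Measure.quasiMeasurePreserving_fst)
  have hsq : ∀ g : Plane → F, eLpNorm g 2 ^ (2 : ℝ) = ∫⁻ z, ‖g z‖ₑ ^ (2 : ℝ) := fun g => by
    simpa using eLpNorm_nnreal_pow_eq_lintegral (μ := volume) (f := g) (p := 2) (by norm_num)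
  refine (ENNReal.rpow_le_rpow_iff (z := 2) (by norm_num)).1 ?_
  rw [hsq]
  calc ∫⁻ z, ‖(ρ ⋆[ContinuousLinearMap.lsmul ℝ ℝ] f - f) z‖ₑ ^ (2 : ℝ)
      ≤ ∫⁻ z, ∫⁻ h, ‖ρ h‖ₑ * ‖f (z - h) - f z‖ₑ ^ (2 : ℝ) := by
        refine lintegral_mono fun z => ?_
        rw [hpt]
        exact enorm_integral_smul_rpow_two_le hρ0 hρi hρ1
          ((aestronglyMeasurable_comp_sub hf.1 z).sub aestronglyMeasurable_const)
    _ = ∫⁻ h, ∫⁻ z, ‖ρ h‖ₑ * ‖f (z - h) - f z‖ₑ ^ (2 : ℝ) := by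
        refine lintegral_lintegral_swap ?_
        exact (hρc.comp continuous_snd).aestronglyMeasurable.enorm.mul
          (hjm.enorm.pow_const (2 : ℝ))
    _ ≤ ∫⁻ h, ‖ρ h‖ₑ * δ ^ (2 : ℝ) := by
        refine lintegral_mono fun h => ?_
        rw [lintegral_const_mul' _ _ (by simp), ← hsq]
        by_cases hh : h ∈ Metric.ball (0 : Plane) φ.rOut
        · gcongr
          exact hδ h hh
        · have : ρ h = 0 := by
            rw [← Function.notMem_support, φ.support_normed_eq]; exact hh
          simp [this]
    _ = δ ^ (2 : ℝ) := by
        rw [lintegral_mul_const'' _ hρi.1.enorm, ← ofReal_integral_norm_eq_lintegral_enorm hρi]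
        simp [Real.norm_of_nonneg (hρ0 _), hρ1]

/-- Mollifications of `f` converge to `f` in `L²`. -/
theorem tendsto_eLpNorm_convolution_sub [CompleteSpace F] {f : Plane → F} (hf : MemLp f 2)
    {φ : ℕ → ContDiffBump (0 : Plane)} (hφ : Tendsto (fun n => (φ n).rOut) atTop (𝓝 0)) :
    Tendsto (fun n => eLpNorm ((φ n).normed volume ⋆[ContinuousLinearMap.lsmul ℝ ℝ] f - f) 2)
      atTop (𝓝 0) := by
  refine ENNReal.tendsto_nhds_zero.2 fun ε hε => ?_
  have h := ENNReal.tendsto_nhds_zero.1 (tendsto_eLpNorm_sub_translate hf) ε hε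
  obtain ⟨r, hr, hball⟩ := Metric.eventually_nhds_iff_ball.1 h
  filter_upwards [hφ.eventually (gt_mem_nhds hr)] with n hn
  exact eLpNorm_convolution_sub_le hf (φ n) fun h hh => hball h (Metric.ball_subset_ball hn.le hh)

/-- The derivative of a mollification is the mollification of the weak derivative. -/
theorem HasWeakDeriv.fderiv_convolution [CompleteSpace F] {e : Plane} {f g : Plane → F}
    (h : HasWeakDeriv e f g) {ρ : Plane → ℝ} (hρ : ContDiff ℝ ∞ ρ) (hc : HasCompactSupport ρ)
    (z : Plane) :
    fderiv ℝ (ρ ⋆[ContinuousLinearMap.lsmul ℝ ℝ] f) z e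
      = (ρ ⋆[ContinuousLinearMap.lsmul ℝ ℝ] g) z := by
  have hd := hc.hasFDerivAt_convolution_left (ContinuousLinearMap.lsmul ℝ ℝ) (μ := volume)
    (hρ.of_le (by simp)) h.1 z
  have hce : HasCompactSupport (fderiv ℝ ρ) := hc.fderiv (𝕜 := ℝ)
  have hex := hce.convolutionExists_left
    ((ContinuousLinearMap.lsmul ℝ ℝ : ℝ →L[ℝ] F →L[ℝ] F).precompL Plane) (μ := volume)
    (hρ.continuous_fderiv (by simp)) h.1 z
  rw [hd.fderiv, convolution_eq_swap, convolution_eq_swap,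
    ContinuousLinearMap.integral_apply]
  swap
  · simpa using! (convolutionExistsAt_iff_integrable_swap).1 hex
  have key := h.2.2 (fun t => ρ (z - t)) (hρ.comp (contDiff_const.sub contDiff_id))
    (hc.comp_homeomorph (Homeomorph.subLeft z))
  have hfd : ∀ t, fderiv ℝ (fun t => ρ (z - t)) t e = - fderiv ℝ ρ (z - t) e := fun t => by
    have hd' : HasFDerivAt (fun t => ρ (z - t)) _ t :=
      (hρ.differentiable (by simp) (z - t)).hasFDerivAt.comp t ((hasFDerivAt_id t).const_sub z)
    rw [hd'.fderiv]
    simp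
  simp only [hfd, neg_smul, integral_neg, neg_inj] at key
  exact key

end

section

open scoped Convolution

variable {F : Type*} [NormedAddCommGroup F] [NormedSpace ℝ F]

/-! ### Smooth approximation in `H¹_loc`, with convergence in `L⁴` -/

theorem L2Loc.memLp_smul {f : Plane → F} (hf : L2Loc f) {η : Plane → ℝ} (hη : Continuous η)
    (hc : HasCompactSupport η) : MemLp (fun z => η z • f z) 2 := by
  have h := (memLp_indicator_iff_restrict (isClosed_tsupport η).measurableSet).2
    (hf.smul hη (tsupport η) hc)
  have e : (tsupport η).indicator (fun z => η z • f z) = fun z => η z • f z := by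
    refine indicator_eq_self.2 fun z hz => ?_
    refine subset_tsupport η (Function.mem_support.2 fun h0 => hz ?_)
    simp [h0]
  rwa [e] at h

/-- A bound for the operator norm; the norm on the plane `ℝ × ℝ` is the supremum norm. -/
theorem norm_le_of_prod (T : Plane →L[ℝ] F) : ‖T‖ ≤ ‖T (1, 0)‖ + ‖T (0, 1)‖ := by
  refine T.opNorm_le_bound (by positivity) fun z => ?_
  have hz : z = z.1 • ((1, 0) : Plane) + z.2 • ((0, 1) : Plane) := by ext <;> simp
  have h1 : ‖z.1‖ ≤ ‖z‖ := norm_fst_le z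
  have h2 : ‖z.2‖ ≤ ‖z‖ := norm_snd_le z
  calc ‖T z‖ = ‖z.1 • T (1, 0) + z.2 • T (0, 1)‖ := by
        conv_lhs => rw [hz]
        rw [map_add, map_smul, map_smul]
    _ ≤ ‖z.1‖ * ‖T (1, 0)‖ + ‖z.2‖ * ‖T (0, 1)‖ := by
        simpa only [norm_smul] using norm_add_le (z.1 • T (1, 0)) (z.2 • T (0, 1))
    _ ≤ ‖z‖ * ‖T (1, 0)‖ + ‖z‖ * ‖T (0, 1)‖ := by gcongr
    _ = (‖T (1, 0)‖ + ‖T (0, 1)‖) * ‖z‖ := by ring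

theorem eLpNorm_fderiv_le {w : Plane → F} (hw : ContDiff ℝ ∞ w) :
    eLpNorm (fderiv ℝ w) 2 ≤ eLpNorm (fun z => fderiv ℝ w z (1, 0)) 2
      + eLpNorm (fun z => fderiv ℝ w z (0, 1)) 2 := by
  have hc1 : Continuous fun z => fderiv ℝ w z (1, 0) := (contDiff_fderiv_apply hw _).continuous
  have hc2 : Continuous fun z => fderiv ℝ w z (0, 1) := (contDiff_fderiv_apply hw _).continuous
  rw [← eLpNorm_norm (fun z => fderiv ℝ w z (1, 0)), ← eLpNorm_norm (fun z => fderiv ℝ w z (0, 1))]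
  refine le_trans ?_ (eLpNorm_add_le hc1.norm.aestronglyMeasurable
    hc2.norm.aestronglyMeasurable one_le_two)
  refine eLpNorm_mono_real fun z => ?_
  rw [Pi.add_apply]
  exact norm_le_of_prod (fderiv ℝ w z)

theorem eLpNorm_le_of_support_subset {E : Type*} [NormedAddCommGroup E] {w : Plane → E}
    {S : Set Plane} {p q : ℝ≥0∞} (hpq : p ≤ q)
    (hw : AEStronglyMeasurable w) (hs : w.support ⊆ S) :
    eLpNorm w p ≤ eLpNorm w q * volume S ^ (1 / p.toReal - 1 / q.toReal) := by
  rw [← eLpNorm_restrict_eq_of_support_subset (ε := E) hs,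
    ← eLpNorm_restrict_eq_of_support_subset (ε := E) (p := q) hs]
  refine (eLpNorm_le_eLpNorm_mul_rpow_measure_univ hpq hw.restrict).trans (le_of_eq ?_)
  rw [Measure.restrict_apply_univ]

/-- The Sobolev embedding `H¹ ⊆ L⁴` for smooth functions supported in a fixed bounded set; it is
the Gagliardo-Nirenberg-Sobolev inequality for an exponent below `2`, combined with Hölder's
inequality. -/
theorem exists_eLpNorm_four_le [FiniteDimensional ℝ F] (R : ℝ) :
    ∃ C : ℝ≥0∞, C ≠ ⊤ ∧ ∀ w : Plane → F, ContDiff ℝ ∞ w → w.support ⊆ Metric.closedBall 0 R →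
      eLpNorm w 4 ≤ C * (eLpNorm (fun z => fderiv ℝ w z (1, 0)) 2
        + eLpNorm (fun z => fderiv ℝ w z (0, 1)) 2) := by
  have hS : IsCompact (Metric.closedBall (0 : Plane) R) := isCompact_closedBall 0 R
  have hrank : Module.finrank ℝ Plane = 2 := by simp [Plane]
  obtain ⟨c, hc⟩ : ∃ c : ℝ≥0, ∀ w : Plane → F, ContDiff ℝ ∞ w →
      w.support ⊆ Metric.closedBall 0 R →
        eLpNorm w (4 : ℝ≥0) ≤ c * eLpNorm (fderiv ℝ w) (3 / 2 : ℝ≥0) := by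
    refine ⟨_, fun w hw hsupp => eLpNorm_le_eLpNorm_fderiv_of_le (volume : Measure Plane)
      (hw.of_le (by simp)) hsupp ?_ ?_ ?_ hS.isBounded⟩
    · rw [← NNReal.coe_le_coe]; norm_num
    · rw [hrank, ← NNReal.coe_lt_coe]; norm_num
    · rw [hrank]; norm_num
  have h32 : ((3 / 2 : ℝ≥0) : ℝ≥0∞) ≤ 2 := by
    have : (3 / 2 : ℝ≥0) ≤ 2 := by rw [← NNReal.coe_le_coe]; norm_num
    exact_mod_cast this
  refine ⟨c * volume (Metric.closedBall (0 : Plane) R) ^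
      (1 / ((3 / 2 : ℝ≥0) : ℝ≥0∞).toReal - 1 / (2 : ℝ≥0∞).toReal), ENNReal.mul_ne_top (by simp)
    (ENNReal.rpow_ne_top_of_nonneg (by norm_num) hS.measure_lt_top.ne), fun w hw hsupp => ?_⟩
  have hsupp' : (fderiv ℝ w).support ⊆ Metric.closedBall 0 R :=
    (support_fderiv_subset ℝ).trans (closure_minimal hsupp Metric.isClosed_closedBall)
  have h2 := eLpNorm_le_of_support_subset h32
    (hw.continuous_fderiv (by simp)).aestronglyMeasurable hsupp'
  refine (hc w hw hsupp).trans ?_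
  rw [mul_assoc]
  refine mul_le_mul_right (h2.trans ?_) _
  rw [mul_comm]
  exact mul_le_mul_right (eLpNorm_fderiv_le hw) _

/-- Smooth functions approximate a compactly supported `H¹` function in `L⁴`, with first
derivatives in `L²`. -/
theorem exists_smooth_approx_of_support_subset [FiniteDimensional ℝ F] {f g₁ g₂ : Plane → F}
    {R : ℝ} (hf : MemLp f 2) (hg₁ : MemLp g₁ 2) (hg₂ : MemLp g₂ 2)
    (h₁ : HasWeakDeriv (1, 0) f g₁) (h₂ : HasWeakDeriv (0, 1) f g₂)
    (hs : f.support ⊆ Metric.closedBall 0 R) :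
    MemLp f 4 ∧ ∃ w : ℕ → Plane → F, (∀ n, ContDiff ℝ ∞ (w n)) ∧
      Tendsto (fun n => eLpNorm (w n - f) 4) atTop (𝓝 0) ∧
      Tendsto (fun n => eLpNorm ((fun z => fderiv ℝ (w n) z (1, 0)) - g₁) 2) atTop (𝓝 0) ∧
      Tendsto (fun n => eLpNorm ((fun z => fderiv ℝ (w n) z (0, 1)) - g₂) 2) atTop (𝓝 0) := by
  have : CompleteSpace F := FiniteDimensional.complete ℝ F
  let φ : ℕ → ContDiffBump (0 : Plane) := fun n =>
    ⟨1 / ((n : ℝ) + 1) / 2, 1 / ((n : ℝ) + 1), half_pos Nat.one_div_pos_of_nat,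
      half_lt_self Nat.one_div_pos_of_nat⟩
  have hφ0 : Tendsto (fun n => (φ n).rOut) atTop (𝓝 0) := tendsto_one_div_add_atTop_nhds_zero_nat
  have hφ1 : ∀ n, (φ n).rOut ≤ 1 := fun n => by
    simp only [φ]
    rw [div_le_one (by positivity)]
    linarith [(Nat.cast_nonneg n : (0 : ℝ) ≤ n)]
  let ρ : ℕ → Plane → ℝ := fun n => (φ n).normed volume
  have hρ : ∀ n, ContDiff ℝ ∞ (ρ n) := fun n => (φ n).contDiff_normed
  have hρc : ∀ n, HasCompactSupport (ρ n) := fun n => (φ n).hasCompactSupport_normed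
  let w : ℕ → Plane → F := fun n => ρ n ⋆[ContinuousLinearMap.lsmul ℝ ℝ] f
  have hw : ∀ n, ContDiff ℝ ∞ (w n) := fun n =>
    (hρc n).contDiff_convolution_left _ (hρ n) h₁.1
  have hw₁ : ∀ n, (fun z => fderiv ℝ (w n) z (1, 0))
      = ρ n ⋆[ContinuousLinearMap.lsmul ℝ ℝ] g₁ := fun n => by
    ext z; exact h₁.fderiv_convolution (hρ n) (hρc n) z
  have hw₂ : ∀ n, (fun z => fderiv ℝ (w n) z (0, 1))
      = ρ n ⋆[ContinuousLinearMap.lsmul ℝ ℝ] g₂ := fun n => by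
    ext z; exact h₂.fderiv_convolution (hρ n) (hρc n) z
  have t₁ : Tendsto (fun n => eLpNorm ((fun z => fderiv ℝ (w n) z (1, 0)) - g₁) 2) atTop (𝓝 0) := by
    simp only [hw₁]
    exact tendsto_eLpNorm_convolution_sub hg₁ hφ0
  have t₂ : Tendsto (fun n => eLpNorm ((fun z => fderiv ℝ (w n) z (0, 1)) - g₂) 2) atTop (𝓝 0) := by
    simp only [hw₂]
    exact tendsto_eLpNorm_convolution_sub hg₂ hφ0
  have hws : ∀ n, (w n).support ⊆ Metric.closedBall 0 (R + 1) := fun n => by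
    refine (support_convolution_subset _).trans ?_
    rintro _ ⟨x, hx, y, hy, rfl⟩
    rw [(φ n).support_normed_eq] at hx
    have hx' := (mem_ball_zero_iff.1 hx).le.trans (hφ1 n)
    have hy' := mem_closedBall_zero_iff.1 (hs hy)
    exact mem_closedBall_zero_iff.2 ((norm_add_le x y).trans (by linarith))
  obtain ⟨C, hC, hsob⟩ := exists_eLpNorm_four_le (F := F) (R + 1)
  have hfd : ∀ n m e, (fun z => fderiv ℝ (w n - w m) z e)
      = (fun z => fderiv ℝ (w n) z e) - fun z => fderiv ℝ (w m) z e := fun n m e => by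
    ext z
    rw [fderiv_sub ((hw n).differentiable (by simp) z) ((hw m).differentiable (by simp) z)]
    rfl
  have hm : ∀ n e, AEStronglyMeasurable fun z => fderiv ℝ (w n) z e := fun n e =>
    (contDiff_fderiv_apply (hw n) e).continuous.aestronglyMeasurable
  have hcau : ∀ n m, eLpNorm (w n - w m) 4
      ≤ C * ((eLpNorm ((fun z => fderiv ℝ (w n) z (1, 0)) - g₁) 2
          + eLpNorm ((fun z => fderiv ℝ (w n) z (0, 1)) - g₂) 2)
        + (eLpNorm ((fun z => fderiv ℝ (w m) z (1, 0)) - g₁) 2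
          + eLpNorm ((fun z => fderiv ℝ (w m) z (0, 1)) - g₂) 2)) := fun n m => by
    refine (hsob (w n - w m) ((hw n).sub (hw m)) ?_).trans ?_
    · intro z hz
      by_contra hz'
      have h1 : w n z = 0 := Function.notMem_support.1 fun h => hz' (hws n h)
      have h2 : w m z = 0 := Function.notMem_support.1 fun h => hz' (hws m h)
      exact hz (by simp [h1, h2])
    · rw [hfd, hfd, add_add_add_comm]
      gcongr
      · rw [← sub_sub_sub_cancel_right _ _ g₁]
        exact eLpNorm_sub_le ((hm n _).sub hg₁.1) ((hm m _).sub hg₁.1) one_le_two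
      · rw [← sub_sub_sub_cancel_right _ _ g₂]
        exact eLpNorm_sub_le ((hm n _).sub hg₂.1) ((hm m _).sub hg₂.1) one_le_two
  have hae : ∀ᵐ z, Tendsto (fun m => w m z) atTop (𝓝 (f z)) :=
    ContDiffBump.ae_convolution_tendsto_right_of_locallyIntegrable (K := 2) hφ0
      (Eventually.of_forall fun n => by simp only [φ]; linarith) h₁.1
  have hwm : ∀ n, AEStronglyMeasurable (w n) := fun n => (hw n).continuous.aestronglyMeasurable
  -- let `m` tend to infinity in the Cauchy estimate, by Fatou's lemma
  have hbd : ∀ n, eLpNorm (w n - f) 4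
      ≤ C * ((eLpNorm ((fun z => fderiv ℝ (w n) z (1, 0)) - g₁) 2
          + eLpNorm ((fun z => fderiv ℝ (w n) z (0, 1)) - g₂) 2)) := fun n => by
    refine (Lp.eLpNorm_lim_le_liminf_eLpNorm (fun m => (hwm n).sub (hwm m)) (w n - f) ?_).trans ?_
    · filter_upwards [hae] with z hz
      exact tendsto_const_nhds.sub hz
    · refine (liminf_le_liminf (Eventually.of_forall (hcau n))).trans (le_of_eq ?_)
      refine Tendsto.liminf_eq ?_
      have := (ENNReal.Tendsto.const_mul (a := C)
        ((tendsto_const_nhds (x := eLpNorm ((fun z => fderiv ℝ (w n) z (1, 0)) - g₁) 2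
          + eLpNorm ((fun z => fderiv ℝ (w n) z (0, 1)) - g₂) 2)).add (t₁.add t₂)) (Or.inr hC))
      simpa using this
  have t₀ : Tendsto (fun n => eLpNorm (w n - f) 4) atTop (𝓝 0) := by
    have := ENNReal.Tendsto.const_mul (a := C) (t₁.add t₂) (Or.inr hC)
    simp only [add_zero, mul_zero] at this
    exact tendsto_of_tendsto_of_tendsto_of_le_of_le tendsto_const_nhds this
      (fun _ => zero_le) hbd
  refine ⟨?_, w, hw, t₀, t₁, t₂⟩
  obtain ⟨n, hn⟩ := (t₀.eventually (gt_mem_nhds one_pos)).exists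
  have hwn : MemLp (w n) 4 := by
    refine (hw n).continuous.memLp_of_hasCompactSupport ?_
    exact HasCompactSupport.of_support_subset_isCompact (isCompact_closedBall _ _) (hws n)
  have : f = w n - (w n - f) := by simp
  rw [this]
  exact hwn.sub ⟨(hwm n).sub hf.1, hn.trans ENNReal.one_lt_top⟩

/-- Functions in `H¹_loc` are in `L⁴_loc`, and on compact sets they are limits of smooth functions
in `L⁴`, with first derivatives in `L²`. -/
theorem H1Loc.exists_smooth_approx [FiniteDimensional ℝ F] {f : Plane → F} (hf : H1Loc f)
    {K : Set Plane} (hK : IsCompact K) :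
    MemLp f 4 (volume.restrict K) ∧ ∃ w : ℕ → Plane → F, (∀ n, ContDiff ℝ ∞ (w n)) ∧
      Tendsto (fun n => eLpNorm (w n - f) 4 (volume.restrict K)) atTop (𝓝 0) ∧
      Tendsto (fun n => eLpNorm ((fun z => fderiv ℝ (w n) z (1, 0)) - dx f) 2 (volume.restrict K))
        atTop (𝓝 0) ∧
      Tendsto (fun n => eLpNorm ((fun z => fderiv ℝ (w n) z (0, 1)) - dy f) 2 (volume.restrict K))
        atTop (𝓝 0) := by
  have : CompleteSpace F := FiniteDimensional.complete ℝ F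
  obtain ⟨r, hr, hKr⟩ := hK.isBounded.subset_ball_lt 0 0
  -- a cutoff function equal to `1` near `K` reduces to the case of compact support
  let χ : ContDiffBump (0 : Plane) := ⟨r, r + 1, hr, by linarith⟩
  have hχ : ContDiff ℝ ∞ χ := χ.contDiff
  have hχc : HasCompactSupport χ := χ.hasCompactSupport
  have hχe := contDiff_fderiv_apply hχ
  have hχce := hasCompactSupport_fderiv_apply hχc
  have hχ1 : ∀ z ∈ K, χ z = 1 := fun z hz =>
    χ.one_of_mem_closedBall (Metric.ball_subset_closedBall (hKr hz))
  have hχ0 : ∀ z ∈ K, fderiv ℝ χ z = 0 := fun z hz => by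
    rw [(χ.eventuallyEq_one_of_mem_ball (hKr hz)).fderiv_eq]
    simp
  obtain ⟨h4, w, hw, t₀, t₁, t₂⟩ := exists_smooth_approx_of_support_subset (R := r + 1)
    (hf.1.memLp_smul hχ.continuous hχc)
    ((hf.l2Loc_dx.memLp_smul hχ.continuous hχc).add
      (hf.1.memLp_smul (hχe (1, 0)).continuous (hχce _)))
    ((hf.l2Loc_dy.memLp_smul hχ.continuous hχc).add
      (hf.1.memLp_smul (hχe (0, 1)).continuous (hχce _)))
    (hf.hasWeakDeriv_dx.smul hχ) (hf.hasWeakDeriv_dy.smul hχ) (by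
      intro z hz
      have : z ∈ Function.support χ := fun h => hz (by simp [h])
      rw [χ.support_eq] at this
      exact Metric.ball_subset_closedBall this)
  have hres : ∀ {p : ℝ≥0∞} {u v v' : Plane → F}, (∀ z ∈ K, v z = v' z) →
      eLpNorm (u - v') p (volume.restrict K) ≤ eLpNorm (u - v) p := by
    intro p u v v' h
    refine le_trans (le_of_eq ?_) (eLpNorm_mono_measure _ (Measure.restrict_le_self (s := K)))
    refine eLpNorm_congr_ae ((ae_restrict_iff' hK.measurableSet).2
      (Eventually.of_forall fun z hz => ?_))
    simp [h z hz]
  have hsq : ∀ {p : ℝ≥0∞} {u : ℕ → Plane → F} {v v' : Plane → F}, (∀ z ∈ K, v z = v' z) →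
      Tendsto (fun n => eLpNorm (u n - v) p) atTop (𝓝 0) →
      Tendsto (fun n => eLpNorm (u n - v') p (volume.restrict K)) atTop (𝓝 0) := by
    intro p u v v' h ht
    exact tendsto_of_tendsto_of_tendsto_of_le_of_le tendsto_const_nhds ht
      (fun _ => zero_le) fun n => hres h
  refine ⟨?_, w, hw, hsq (fun z hz => by simp [hχ1 z hz]) t₀,
    hsq (fun z hz => by simp [hχ1 z hz, hχ0 z hz]) t₁,
    hsq (fun z hz => by simp [hχ1 z hz, hχ0 z hz]) t₂⟩
  refine (memLp_congr_ae ((ae_restrict_iff' hK.measurableSet).2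
      (Eventually.of_forall fun z hz => ?_))).1 (h4.restrict K)
  simp [hχ1 z hz]

end

section

/-! ### Convergence of products in `Lᵖ` -/

section LpTendsto

variable {α E F G : Type*} [MeasurableSpace α] {ν : Measure α} {p q r : ℝ≥0∞}
  [NormedAddCommGroup E] [NormedAddCommGroup F] [NormedAddCommGroup G]

/-- The functions `w n` and their limit `f` are in `Lᵖ(ν)`, and `w n → f` in `Lᵖ(ν)`. -/
structure LpTendsto (p : ℝ≥0∞) (ν : Measure α) (w : ℕ → α → E) (f : α → E) : Prop where
  memLp : ∀ n, MemLp (w n) p ν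
  memLp_lim : MemLp f p ν
  tendsto : Tendsto (fun n => eLpNorm (w n - f) p ν) atTop (𝓝 0)

theorem LpTendsto.const {f : α → E} (hf : MemLp f p ν) : LpTendsto p ν (fun _ => f) f :=
  ⟨fun _ => hf, hf, by simp⟩

theorem LpTendsto.add {w v : ℕ → α → E} {f g : α → E} (hw : LpTendsto p ν w f)
    (hv : LpTendsto p ν v g) (hp : 1 ≤ p) :
    LpTendsto p ν (fun n z => w n z + v n z) fun z => f z + g z := by
  refine ⟨fun n => (hw.memLp n).add (hv.memLp n), hw.memLp_lim.add hv.memLp_lim, ?_⟩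
  have := hw.tendsto.add hv.tendsto
  rw [add_zero] at this
  refine tendsto_of_tendsto_of_tendsto_of_le_of_le tendsto_const_nhds this
    (fun _ => zero_le) fun n => ?_
  refine le_trans (le_of_eq ?_) (eLpNorm_add_le ((hw.memLp n).sub hw.memLp_lim).1
    ((hv.memLp n).sub hv.memLp_lim).1 hp)
  congr 1
  ext z
  simp only [Pi.sub_apply, Pi.add_apply]
  abel

variable [NormedSpace ℝ E] [NormedSpace ℝ F] [NormedSpace ℝ G]

/-- Hölder's inequality: bilinear maps of convergent sequences converge. -/
theorem LpTendsto.bilin [ENNReal.HolderTriple p q r] (hr : 1 ≤ r) (B : E →L[ℝ] F →L[ℝ] G)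
    {w : ℕ → α → E} {f : α → E} {v : ℕ → α → F} {g : α → F} (hw : LpTendsto p ν w f)
    (hv : LpTendsto q ν v g) :
    LpTendsto r ν (fun n z => B (w n z) (v n z)) fun z => B (f z) (g z) := by
  have hm : ∀ {a : α → E} {b : α → F}, MemLp a p ν → MemLp b q ν →
      MemLp (fun z => B (a z) (b z)) r ν := fun ha hb =>
    MemLp.of_bilin (fun x y => B x y) ‖B‖₊ ha hb
      (B.aestronglyMeasurable_comp₂ ha.1 hb.1) (Eventually.of_forall fun z => B.le_opNorm₂ _ _)
  have hle : ∀ {a : α → E} {b : α → F}, MemLp a p ν → MemLp b q ν →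
      eLpNorm (fun z => B (a z) (b z)) r ν ≤ ‖B‖₊ * eLpNorm a p ν * eLpNorm b q ν :=
    fun ha hb => eLpNorm_le_eLpNorm_mul_eLpNorm_of_nnnorm ha.1 hb.1 (fun x y => B x y) ‖B‖₊
      (Eventually.of_forall fun z => B.le_opNorm₂ _ _)
  refine ⟨fun n => hm (hw.memLp n) (hv.memLp n), hm hw.memLp_lim hv.memLp_lim, ?_⟩
  have hw' := fun n => (hw.memLp n).sub hw.memLp_lim
  have hv' := fun n => (hv.memLp n).sub hv.memLp_lim
  have hbound : ∀ n, eLpNorm ((fun z => B (w n z) (v n z)) - fun z => B (f z) (g z)) r ν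
      ≤ ‖B‖₊ * eLpNorm (w n - f) p ν * eLpNorm (v n - g) q ν
        + ‖B‖₊ * eLpNorm (w n - f) p ν * eLpNorm g q ν
        + ‖B‖₊ * eLpNorm f p ν * eLpNorm (v n - g) q ν := fun n => by
    have e : ((fun z => B (w n z) (v n z)) - fun z => B (f z) (g z))
        = ((fun z => B ((w n - f) z) ((v n - g) z)) + fun z => B ((w n - f) z) (g z))
          + fun z => B (f z) ((v n - g) z) := by
      ext z
      simp only [Pi.sub_apply, Pi.add_apply, map_sub, sub_apply]
      abel
    rw [e]
    refine (eLpNorm_add_le ((hm (hw' n) (hv' n)).add (hm (hw' n) hv.memLp_lim)).1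
      (hm hw.memLp_lim (hv' n)).1 hr).trans (add_le_add ?_ (hle hw.memLp_lim (hv' n)))
    exact (eLpNorm_add_le (hm (hw' n) (hv' n)).1 (hm (hw' n) hv.memLp_lim).1 hr).trans
      (add_le_add (hle (hw' n) (hv' n)) (hle (hw' n) hv.memLp_lim))
  have hB : (‖B‖₊ : ℝ≥0∞) ≠ ⊤ := by simp
  have t1 := ENNReal.Tendsto.const_mul hw.tendsto (Or.inr hB)
  rw [mul_zero] at t1
  have t2 := ENNReal.Tendsto.mul t1 (Or.inr ENNReal.zero_ne_top) hv.tendsto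
    (Or.inr ENNReal.zero_ne_top)
  have t3 := ENNReal.Tendsto.mul_const t1 (Or.inr hv.memLp_lim.2.ne)
  have t4 := ENNReal.Tendsto.const_mul hv.tendsto
    (Or.inr (ENNReal.mul_ne_top hB hw.memLp_lim.2.ne))
  have t := (t2.add t3).add t4
  simp only [mul_zero, zero_mul, add_zero] at t
  exact tendsto_of_tendsto_of_tendsto_of_le_of_le tendsto_const_nhds t (fun _ => zero_le) hbound

theorem LpTendsto.clm (T : E →L[ℝ] F) {w : ℕ → α → E} {f : α → E}
    (hw : LpTendsto p ν w f) : LpTendsto p ν (fun n z => T (w n z)) fun z => T (f z) := by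
  refine ⟨fun n => T.comp_memLp' (hw.memLp n), T.comp_memLp' hw.memLp_lim, ?_⟩
  have t := ENNReal.Tendsto.const_mul (a := (‖T‖₊ : ℝ≥0∞)) hw.tendsto (Or.inr (by simp))
  rw [mul_zero] at t
  refine tendsto_of_tendsto_of_tendsto_of_le_of_le tendsto_const_nhds t (fun _ => zero_le)
    fun n => ?_
  refine eLpNorm_le_nnreal_smul_eLpNorm_of_ae_le_mul (Eventually.of_forall fun z => ?_) p
  simp only [Pi.sub_apply, ← map_sub]
  exact T.le_opNorm _

theorem LpTendsto.sub {w v : ℕ → α → E} {f g : α → E} (hw : LpTendsto p ν w f)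
    (hv : LpTendsto p ν v g) (hp : 1 ≤ p) :
    LpTendsto p ν (fun n z => w n z - v n z) fun z => f z - g z := by
  simpa [sub_eq_add_neg] using hw.add (hv.clm (-ContinuousLinearMap.id ℝ E)) hp

theorem LpTendsto.mul [ENNReal.HolderTriple p q r] (hr : 1 ≤ r) {w v : ℕ → α → ℝ} {f g : α → ℝ}
    (hw : LpTendsto p ν w f) (hv : LpTendsto q ν v g) :
    LpTendsto r ν (fun n z => w n z * v n z) fun z => f z * g z :=
  hw.bilin hr (ContinuousLinearMap.mul ℝ ℝ) hv

theorem LpTendsto.inner {H : Type*} [NormedAddCommGroup H] [InnerProductSpace ℝ H]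
    [ENNReal.HolderTriple p q r] (hr : 1 ≤ r) {w v : ℕ → α → H} {f g : α → H}
    (hw : LpTendsto p ν w f) (hv : LpTendsto q ν v g) :
    LpTendsto r ν (fun n z => inner ℝ (w n z) (v n z)) fun z => inner ℝ (f z) (g z) :=
  hw.bilin hr (innerSL ℝ) hv

theorem LpTendsto.integral_tendsto {w : ℕ → α → E} {f : α → E}
    (hw : LpTendsto 1 ν w f) : Tendsto (fun n => ∫ z, w n z ∂ν) atTop (𝓝 (∫ z, f z ∂ν)) := by
  refine tendsto_integral_of_L1 f (memLp_one_iff_integrable.1 hw.memLp_lim).1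
    (Eventually.of_forall fun n => memLp_one_iff_integrable.1 (hw.memLp n)) ?_
  simpa [eLpNorm_one_eq_lintegral_enorm] using hw.tendsto

end LpTendsto

instance holderTriple_four_four_two : ENNReal.HolderTriple (4 : ℝ≥0∞) 4 2 where
  inv_add_inv_eq_inv := by
    rw [← two_mul, ← ENNReal.toReal_eq_toReal_iff' (by finiteness) (by simp)]
    simp
    norm_num

/-! ### The weak Bogomolny identity -/

/-- The component `i ∂u + A u` of the covariant derivative, where `u'` is a partial derivative of
`u` and `A` is the corresponding component of the vector potential. -/
def cov (A : Plane → ℝ) (u u' : Plane → ℂ) (z : Plane) : ℂ :=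
  Complex.I * u' z + (A z : ℂ) * u z

/-- The integrand of the weak form of
`∂ₓ⟪u, D_y u⟫ - ∂_y⟪u, Dₓ u⟫ = B |u|² - 2 Im (conj (Dₓ u) D_y u)`, tested with a function `φ`
whose partial derivatives are `φ₁` and `φ₂`. -/
def bogomolnyIntegrand (φ φ₁ φ₂ : Plane → ℝ) (A₁ A₂ B : Plane → ℝ) (u u₁ u₂ : Plane → ℂ)
    (z : Plane) : ℝ :=
  φ z * (2 * inner ℝ (Complex.I * cov A₁ u u₁ z) (cov A₂ u u₂ z) - B z * inner ℝ (u z) (u z))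
    - (φ₁ z * inner ℝ (u z) (cov A₂ u u₂ z) - φ₂ z * inner ℝ (u z) (cov A₁ u u₁ z))

theorem fderiv_fderiv_comm {f : Plane → ℝ} (hf : ContDiff ℝ ∞ f) (z e e' : Plane) :
    fderiv ℝ (fun w => fderiv ℝ f w e) z e' = fderiv ℝ (fun w => fderiv ℝ f w e') z e := by
  have hd : DifferentiableAt ℝ (fderiv ℝ f) z :=
    (hf.fderiv_right (m := ∞) (by simp)).differentiable (by simp) z
  have hs : IsSymmSndFDerivAt ℝ f z := hf.contDiffAt.isSymmSndFDerivAt (by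
    simpa using WithTop.coe_le_coe.2 (le_top : (2 : ℕ∞) ≤ ⊤))
  rw [fderiv_clm_apply hd (by fun_prop), fderiv_clm_apply hd (by fun_prop)]
  simpa using! hs e' e

/-- The weak Bogomolny identity for smooth `u`. Only the vector potential is differentiated weakly:
its derivatives are tested with `φ |u|²`. -/
theorem integral_bogomolnyIntegrand_of_contDiff {A₁ A₂ b₁ b₂ : Plane → ℝ}
    (h₁ : HasWeakDeriv (0, 1) A₁ b₁) (h₂ : HasWeakDeriv (1, 0) A₂ b₂) {φ : Plane → ℝ}
    (hφ : ContDiff ℝ ∞ φ) (hc : HasCompactSupport φ) {u : Plane → ℂ} (hu : ContDiff ℝ ∞ u) :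
    ∫ z, bogomolnyIntegrand φ (fun z => fderiv ℝ φ z (1, 0)) (fun z => fderiv ℝ φ z (0, 1))
      A₁ A₂ (fun z => b₂ z - b₁ z) u (fun z => fderiv ℝ u z (1, 0))
      (fun z => fderiv ℝ u z (0, 1)) z = 0 := by
  set P : Plane → ℝ := fun z => (u z).re with hP
  set Q : Plane → ℝ := fun z => (u z).im with hQ
  have hPs : ContDiff ℝ ∞ P := Complex.reCLM.contDiff.comp hu
  have hQs : ContDiff ℝ ∞ Q := Complex.imCLM.contDiff.comp hu
  have hd : ∀ {f : Plane → ℝ}, ContDiff ℝ ∞ f → ∀ z, DifferentiableAt ℝ f z :=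
    fun hf z => hf.differentiable (by simp) z
  have hre : ∀ z e, (fderiv ℝ u z e).re = fderiv ℝ P z e := fun z e => by
    have := (Complex.reCLM.hasFDerivAt.comp z (hu.differentiable (by simp) z).hasFDerivAt).fderiv
    exact (congrArg (fun T : Plane →L[ℝ] ℝ => T e) this).symm
  have him : ∀ z e, (fderiv ℝ u z e).im = fderiv ℝ Q z e := fun z e => by
    have := (Complex.imCLM.hasFDerivAt.comp z (hu.differentiable (by simp) z).hasFDerivAt).fderiv
    exact (congrArg (fun T : Plane →L[ℝ] ℝ => T e) this).symm
  have hmul : ∀ {f g : Plane → ℝ}, ContDiff ℝ ∞ f → ContDiff ℝ ∞ g → ∀ z e,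
      fderiv ℝ (fun z => f z * g z) z e = f z * fderiv ℝ g z e + g z * fderiv ℝ f z e := by
    intro f g hf hg z e
    rw [fderiv_fun_mul (hd hf z) (hd hg z)]
    simp
  -- `J e = Re u ∂ₑ(Im u) - Im u ∂ₑ(Re u)` is the current in the direction `e`
  let J : Plane → Plane → ℝ := fun e z => P z * fderiv ℝ Q z e - Q z * fderiv ℝ P z e
  let N : Plane → ℝ := fun z => P z * P z + Q z * Q z
  have hPe := contDiff_fderiv_apply hPs
  have hQe := contDiff_fderiv_apply hQs
  have hJ : ∀ e, ContDiff ℝ ∞ (J e) := fun e => (hPs.mul (hQe e)).sub (hQs.mul (hPe e))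
  have hN : ContDiff ℝ ∞ N := (hPs.mul hPs).add (hQs.mul hQs)
  have hJd : ∀ e e' z, fderiv ℝ (J e) z e' = P z * fderiv ℝ (fun w => fderiv ℝ Q w e) z e'
      + fderiv ℝ Q z e * fderiv ℝ P z e' - (Q z * fderiv ℝ (fun w => fderiv ℝ P w e) z e'
      + fderiv ℝ P z e * fderiv ℝ Q z e') := fun e e' z => by
    simp only [J]
    rw [fderiv_fun_sub (hd (hPs.mul (hQe e)) z) (hd (hQs.mul (hPe e)) z),
      sub_apply, hmul hPs (hQe e), hmul hQs (hPe e)]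
  have hNd : ∀ e z, fderiv ℝ N z e = 2 * (P z * fderiv ℝ P z e + Q z * fderiv ℝ Q z e) :=
    fun e z => by
    simp only [N]
    rw [fderiv_fun_add (hd (hPs.mul hPs) z) (hd (hQs.mul hQs) z),
      add_apply, hmul hPs hPs, hmul hQs hQs]
    ring
  have key : ∀ z, bogomolnyIntegrand φ (fun z => fderiv ℝ φ z (1, 0))
      (fun z => fderiv ℝ φ z (0, 1)) A₁ A₂ (fun z => b₂ z - b₁ z) u
      (fun z => fderiv ℝ u z (1, 0)) (fun z => fderiv ℝ u z (0, 1)) z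
      = (fderiv ℝ (fun z => φ z * J (0, 1) z) z (1, 0)
          - fderiv ℝ (fun z => φ z * J (1, 0) z) z (0, 1))
        + ((fderiv ℝ (fun z => φ z * N z) z (0, 1) • A₁ z + (φ z * N z) • b₁ z)
          - (fderiv ℝ (fun z => φ z * N z) z (1, 0) • A₂ z + (φ z * N z) • b₂ z)) := fun z => by
    have hc1 := fderiv_fderiv_comm hPs z (1, 0) (0, 1)
    have hc2 := fderiv_fderiv_comm hQs z (1, 0) (0, 1)
    rw [hmul hφ (hJ _), hmul hφ (hJ _), hmul hφ hN, hmul hφ hN, hJd, hJd, hNd, hNd, hc1, hc2]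
    simp only [bogomolnyIntegrand, cov, Complex.inner, J, N, Complex.add_re, Complex.add_im,
      Complex.mul_re, Complex.mul_im, Complex.conj_re, Complex.conj_im, Complex.I_re, Complex.I_im,
      Complex.ofReal_re, Complex.ofReal_im, hre, him, smul_eq_mul, map_add, map_mul]
    have eP : (u z).re = P z := rfl
    have eQ : (u z).im = Q z := rfl
    rw [eP, eQ]
    ring
  have hφJ : ∀ e, ContDiff ℝ ∞ fun z => φ z * J e z := fun e => hφ.mul (hJ e)
  have hφJc : ∀ e, HasCompactSupport fun z => φ z * J e z := fun e => hc.mul_right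
  have hφN : ContDiff ℝ ∞ fun z => φ z * N z := hφ.mul hN
  have hφNc : HasCompactSupport fun z => φ z * N z := hc.mul_right
  have iJ : ∀ e e', Integrable fun z => fderiv ℝ (fun z => φ z * J e z) z e' := fun e e' =>
    (contDiff_fderiv_apply (hφJ e) e').continuous.integrable_of_hasCompactSupport
      (hasCompactSupport_fderiv_apply (hφJc e) e')
  have iA : ∀ {A : Plane → ℝ} (e), LocallyIntegrable A →
      Integrable fun z => fderiv ℝ (fun z => φ z * N z) z e • A z := fun e hA =>
    integrable_smul_of_testFunction hA (contDiff_fderiv_apply hφN e).continuous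
      (hasCompactSupport_fderiv_apply hφNc e)
  have ib : ∀ {b : Plane → ℝ}, LocallyIntegrable b →
      Integrable fun z => (φ z * N z) • b z := fun hb =>
    integrable_smul_of_testFunction hb hφN.continuous hφNc
  have z₁ : ∫ z, (fderiv ℝ (fun z => φ z * N z) z (0, 1) • A₁ z + (φ z * N z) • b₁ z) = 0 := by
    rw [integral_add (iA _ h₁.1) (ib h₁.2.1), h₁.2.2 _ hφN hφNc, neg_add_cancel]
  have z₂ : ∫ z, (fderiv ℝ (fun z => φ z * N z) z (1, 0) • A₂ z + (φ z * N z) • b₂ z) = 0 := by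
    rw [integral_add (iA _ h₂.1) (ib h₂.2.1), h₂.2.2 _ hφN hφNc, neg_add_cancel]
  have i₁ := (iA (0, 1) h₁.1).add (ib h₁.2.1)
  have i₂ := (iA (1, 0) h₂.1).add (ib h₂.2.1)
  rw [integral_congr_ae (Eventually.of_forall key)]
  refine (integral_add ((iJ (0, 1) (1, 0)).sub (iJ (1, 0) (0, 1))) (i₁.sub i₂)).trans ?_
  rw [integral_sub' (iJ _ _) (iJ _ _), integral_sub' i₁ i₂]
  simp only [Pi.add_apply]
  rw [z₁, z₂, integral_fderiv_eq_zero (hφJ _) (hφJc _), integral_fderiv_eq_zero (hφJ _) (hφJc _)]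
  simp

end

section

theorem LpTendsto.ofReal_mul {α : Type*} [MeasurableSpace α] {ν : Measure α} {p q r : ℝ≥0∞}
    [ENNReal.HolderTriple p q r] (hr : 1 ≤ r) {a : ℕ → α → ℝ} {b : α → ℝ} {w : ℕ → α → ℂ}
    {f : α → ℂ} (ha : LpTendsto p ν a b) (hw : LpTendsto q ν w f) :
    LpTendsto r ν (fun n z => (a n z : ℂ) * w n z) fun z => (b z : ℂ) * f z := by
  simpa using ha.bilin hr (ContinuousLinearMap.lsmul ℝ ℝ : ℝ →L[ℝ] ℂ →L[ℝ] ℂ) hw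

theorem LpTendsto.cov {ν : Measure Plane} {A : Plane → ℝ} {w w' : ℕ → Plane → ℂ}
    {u u' : Plane → ℂ} (hA : MemLp A 4 ν) (hw : LpTendsto 4 ν w u) (hw' : LpTendsto 2 ν w' u') :
    LpTendsto 2 ν (fun n => cov A (w n) (w' n)) (cov A u u') :=
  (hw'.clm (ContinuousLinearMap.mul ℝ ℂ Complex.I)).add
    ((LpTendsto.const hA).ofReal_mul one_le_two hw) one_le_two

theorem LpTendsto.bogomolnyIntegrand {ν : Measure Plane} [IsFiniteMeasure ν]
    {φ φ₁ φ₂ A₁ A₂ B : Plane → ℝ} {w w₁ w₂ : ℕ → Plane → ℂ} {u u₁ u₂ : Plane → ℂ}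
    (hφ : MemLp φ ⊤ ν) (hφ₁ : MemLp φ₁ ⊤ ν) (hφ₂ : MemLp φ₂ ⊤ ν)
    (hA₁ : MemLp A₁ 4 ν) (hA₂ : MemLp A₂ 4 ν) (hB : MemLp B 2 ν)
    (hw : LpTendsto 4 ν w u) (hw₁ : LpTendsto 2 ν w₁ u₁) (hw₂ : LpTendsto 2 ν w₂ u₂) :
    LpTendsto 1 ν (fun n => bogomolnyIntegrand φ φ₁ φ₂ A₁ A₂ B (w n) (w₁ n) (w₂ n))
      (bogomolnyIntegrand φ φ₁ φ₂ A₁ A₂ B u u₁ u₂) := by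
  have h24 : (2 : ℝ≥0∞) ≤ 4 := by norm_num
  have hw2 : LpTendsto 2 ν w u := by
    refine ⟨fun n => (hw.memLp n).mono_exponent h24, hw.memLp_lim.mono_exponent h24, ?_⟩
    have t := ENNReal.Tendsto.mul_const
      (b := ν univ ^ (1 / (2 : ℝ≥0∞).toReal - 1 / (4 : ℝ≥0∞).toReal)) hw.tendsto (Or.inr (ENNReal.rpow_ne_top_of_nonneg (by norm_num) (measure_ne_top ν _)))
    rw [zero_mul] at t
    exact tendsto_of_tendsto_of_tendsto_of_le_of_le tendsto_const_nhds t (fun _ => zero_le)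
      fun n => eLpNorm_le_eLpNorm_mul_rpow_measure_univ h24 ((hw.memLp n).sub hw.memLp_lim).1
  have hX := LpTendsto.cov hA₁ hw hw₁
  have hY := LpTendsto.cov hA₂ hw hw₂
  have hXY : LpTendsto 1 ν _ _ :=
    (hX.clm (ContinuousLinearMap.mul ℝ ℂ Complex.I)).inner le_rfl hY
  have hBs : LpTendsto 1 ν _ _ :=
    (LpTendsto.const hB).mul le_rfl (hw.inner (p := 4) (q := 4) (r := 2) one_le_two hw)
  have hb := (hXY.clm (ContinuousLinearMap.mul ℝ ℝ 2)).sub hBs le_rfl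
  have h1 : LpTendsto 1 ν _ _ := (LpTendsto.const hφ).mul le_rfl hb
  have h2 : LpTendsto 1 ν _ _ :=
    (LpTendsto.const hφ₁).mul le_rfl (hw2.inner (r := 1) le_rfl hY)
  have h3 : LpTendsto 1 ν _ _ :=
    (LpTendsto.const hφ₂).mul le_rfl (hw2.inner (r := 1) le_rfl hX)
  exact h1.sub (h2.sub h3 le_rfl) le_rfl

/-- The weak Bogomolny identity for `u` and the vector potential in `H¹_loc`. -/
theorem integral_bogomolnyIntegrand {u : Plane → ℂ} {A₁ A₂ : Plane → ℝ} (hu : H1Loc u)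
    (hA₁ : H1Loc A₁) (hA₂ : H1Loc A₂) {φ : Plane → ℝ} (hφ : ContDiff ℝ ∞ φ)
    (hc : HasCompactSupport φ) :
    ∫ z, bogomolnyIntegrand φ (fun z => fderiv ℝ φ z (1, 0)) (fun z => fderiv ℝ φ z (0, 1))
      A₁ A₂ (fun z => dx A₂ z - dy A₁ z) u (dx u) (dy u) z = 0 := by
  have hK : IsCompact (tsupport φ) := hc
  have hfin : IsFiniteMeasure (volume.restrict (tsupport φ)) :=
    ⟨by simpa using hK.measure_lt_top⟩
  have hφe := contDiff_fderiv_apply hφ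
  have hsupp : ∀ {v v₁ v₂ : Plane → ℂ}, ∫ z, bogomolnyIntegrand φ (fun z => fderiv ℝ φ z (1, 0))
        (fun z => fderiv ℝ φ z (0, 1)) A₁ A₂ (fun z => dx A₂ z - dy A₁ z) v v₁ v₂ z
      = ∫ z in tsupport φ, bogomolnyIntegrand φ (fun z => fderiv ℝ φ z (1, 0))
        (fun z => fderiv ℝ φ z (0, 1)) A₁ A₂ (fun z => dx A₂ z - dy A₁ z) v v₁ v₂ z := by
    intro v v₁ v₂
    refine (setIntegral_eq_integral_of_forall_compl_eq_zero fun z hz => ?_).symm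
    have h0 : φ z = 0 := image_eq_zero_of_notMem_tsupport hz
    have h1 : fderiv ℝ φ z = 0 :=
      Function.notMem_support.1 fun h => hz (support_fderiv_subset ℝ h)
    simp [bogomolnyIntegrand, h0, h1]
  have hbdd : ∀ {η : Plane → ℝ}, Continuous η → MemLp η ⊤ (volume.restrict (tsupport φ)) := by
    intro η hη
    obtain ⟨C, hC⟩ := hK.exists_bound_of_continuousOn hη.continuousOn
    exact memLp_top_of_bound hη.aestronglyMeasurable C
      ((ae_restrict_iff' hK.measurableSet).2 (Eventually.of_forall hC))
  obtain ⟨hu4, w, hw, t₀, t₁, t₂⟩ := hu.exists_smooth_approx hK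
  have hm : ∀ {g : Plane → ℂ} {p : ℝ≥0∞}, Continuous g →
      MemLp g p (volume.restrict (tsupport φ)) := by
    intro g p hg
    obtain ⟨C, hC⟩ := hK.exists_bound_of_continuousOn hg.continuousOn
    exact MemLp.of_bound hg.aestronglyMeasurable C
      ((ae_restrict_iff' hK.measurableSet).2 (Eventually.of_forall hC))
  have lim := (LpTendsto.bogomolnyIntegrand (hbdd hφ.continuous) (hbdd (hφe (1, 0)).continuous)
    (hbdd (hφe (0, 1)).continuous) (hA₁.exists_smooth_approx hK).1 (hA₂.exists_smooth_approx hK).1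
    ((hA₂.l2Loc_dx _ hK).sub (hA₁.l2Loc_dy _ hK))
    ⟨fun n => hm (hw n).continuous, hu4, t₀⟩
    ⟨fun n => hm (contDiff_fderiv_apply (hw n) _).continuous, hu.l2Loc_dx _ hK, t₁⟩
    ⟨fun n => hm (contDiff_fderiv_apply (hw n) _).continuous, hu.l2Loc_dy _ hK,
      t₂⟩).integral_tendsto
  rw [hsupp]
  refine tendsto_nhds_unique lim (tendsto_const_nhds.congr fun n => ?_)
  exact (integral_bogomolnyIntegrand_of_contDiff hA₁.hasWeakDeriv_dy hA₂.hasWeakDeriv_dx hφ hc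
    (hw n)).symm.trans hsupp

theorem H1Loc.l2Loc_cov {A : Plane → ℝ} {u u' : Plane → ℂ} (hA : H1Loc A) (hu : H1Loc u)
    (hu' : L2Loc u') : L2Loc (cov A u u') := fun K hK =>
  (LpTendsto.cov (hA.exists_smooth_approx hK).1 (LpTendsto.const (hu.exists_smooth_approx hK).1)
    (LpTendsto.const (hu' K hK))).memLp_lim

theorem L2Loc.locallyIntegrable_inner {u v : Plane → ℂ} (hu : L2Loc u) (hv : L2Loc v) :
    LocallyIntegrable fun z => (inner ℝ (u z) (v z) : ℝ) :=
  locallyIntegrable_iff.2 fun K hK => memLp_one_iff_integrable.1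
    ((LpTendsto.const (hu K hK)).inner (r := 1) le_rfl (LpTendsto.const (hv K hK))).memLp_lim

theorem H1Loc.l2Loc_inner_self {u : Plane → ℂ} (hu : H1Loc u) :
    L2Loc fun z => (inner ℝ (u z) (u z) : ℝ) := fun K hK => by
  have h := LpTendsto.const (hu.exists_smooth_approx hK).1
  exact (h.inner (r := 2) one_le_two h).memLp_lim

theorem L2Loc.locallyIntegrable_mul {f g : Plane → ℝ} (hf : L2Loc f) (hg : L2Loc g) :
    LocallyIntegrable fun z => f z * g z :=
  locallyIntegrable_iff.2 fun K hK => memLp_one_iff_integrable.1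
    ((LpTendsto.const (hf K hK)).mul (r := 1) le_rfl (LpTendsto.const (hg K hK))).memLp_lim

end

section

/-! ### Integrals of periodic functions -/

variable {L : Submodule ℤ Plane} {E : Type*} [NormedAddCommGroup E]

/-- `f` is `L`-periodic, up to null sets. -/
def PeriodicAE {E : Type*} (L : Submodule ℤ Plane) (f : Plane → E) : Prop :=
  ∀ v ∈ L, ∀ᵐ z : Plane, f (z + v) = f z

theorem ae_comp_add {p : Plane → Prop} (h : ∀ᵐ z, p z) (v : Plane) : ∀ᵐ z, p (z + v) :=
  (measurePreserving_add_right volume v).quasiMeasurePreserving.ae h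

theorem PeriodicAE.congr {E : Type*} {f g : Plane → E} (hf : PeriodicAE L f)
    (h : f =ᵐ[volume] g) : PeriodicAE L g := fun v hv => by
  filter_upwards [hf v hv, h, ae_comp_add h v] with z h1 h2 h3
  rw [← h2, ← h3, h1]

theorem PeriodicAE.map {E E' : Type*} {f : Plane → E} (hf : PeriodicAE L f) (T : E → E') :
    PeriodicAE L fun z => T (f z) :=
  fun v hv => (hf v hv).mono fun z hz => by simp only [hz]

theorem PeriodicAE.map₂ {E₁ E₂ E' : Type*} {f : Plane → E₁} {g : Plane → E₂}
    (hf : PeriodicAE L f) (hg : PeriodicAE L g) (T : E₁ → E₂ → E') :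
    PeriodicAE L fun z => T (f z) (g z) := fun v hv => by
  filter_upwards [hf v hv, hg v hv] with z h1 h2
  rw [h1, h2]

theorem periodicAE_of_basis {E : Type*} (b : Module.Basis (Fin 2) ℤ L) {f : Plane → E}
    (h : ∀ j, ∀ᵐ z : Plane, f (z + (b j : Plane)) = f z) : PeriodicAE L f := by
  let S : AddSubgroup Plane :=
    { carrier := {v | ∀ᵐ z : Plane, f (z + v) = f z}
      zero_mem' := by simp
      add_mem' := fun {v w} hv hw => by
        change ∀ᵐ z : Plane, f (z + (v + w)) = f z
        filter_upwards [ae_comp_add hw v, hv] with z h1 h2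
        rw [← add_assoc, h1, h2]
      neg_mem' := fun {v} hv => by
        change ∀ᵐ z : Plane, f (z + -v) = f z
        filter_upwards [ae_comp_add hv (-v)] with z h1
        rw [neg_add_cancel_right] at h1
        exact h1.symm }
  intro v hv
  have hS : ∀ j, (b j : Plane) ∈ S := h
  change v ∈ S
  have hsum : v = ∑ j, b.repr ⟨v, hv⟩ j • (b j : Plane) := by
    have e : v = ((∑ j, b.repr ⟨v, hv⟩ j • b j : L) : Plane) := by rw [b.sum_repr]
    exact e.trans (by rw [Submodule.coe_sum]; rfl)
  rw [hsum]
  exact S.sum_mem fun j _ => S.zsmul_mem (hS j) _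

/-- A function that is periodic up to null sets agrees almost everywhere with one that is periodic
at every point: set it to zero on the invariant null set where the periodicity fails. -/
theorem PeriodicAE.exists_invariant [Countable L] {f : Plane → E} (hf : PeriodicAE L f) :
    ∃ g : Plane → E, f =ᵐ[volume] g ∧ ∀ (v : L) (z : Plane), g (v +ᵥ z) = g z := by
  let N : Set Plane := {z | ∀ v : L, f (z + v) = f z}
  have hN : ∀ᵐ z, z ∈ N := ae_all_iff.2 fun v => hf v v.2
  have hinv : ∀ (v : L) (z : Plane), z ∈ N → z + v ∈ N := fun v z hz w => by
    have := hz (v + w)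
    rw [hz v, ← this, add_assoc]
    rfl
  have hiff : ∀ (v : L) (z : Plane), z + v ∈ N ↔ z ∈ N := fun v z =>
    ⟨fun h => by simpa using hinv (-v) _ h, hinv v z⟩
  refine ⟨N.indicator f, ?_, fun v z => ?_⟩
  · filter_upwards [hN] with z hz
    rw [indicator_of_mem hz]
  · have e : v +ᵥ z = z + v := by rw [add_comm]; rfl
    rw [e]
    by_cases hz : z ∈ N
    · rw [indicator_of_mem hz, indicator_of_mem ((hiff v z).2 hz), hz v]
    · rw [indicator_of_notMem hz, indicator_of_notMem fun h => hz ((hiff v z).1 h)]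

section

variable {Ω D : Set Plane} [Countable L]

instance vaddInvariantMeasure_submodule : VAddInvariantMeasure L Plane volume :=
  inferInstanceAs (VAddInvariantMeasure L.toAddSubgroup Plane volume)

theorem PeriodicAE.integrableOn_iff {f : Plane → E} (hf : PeriodicAE L f)
    (hΩ : IsAddFundamentalDomain L Ω (volume : Measure Plane))
    (hD : IsAddFundamentalDomain L D (volume : Measure Plane)) :
    IntegrableOn f Ω ↔ IntegrableOn f D := by
  obtain ⟨g, hg, hinv⟩ := hf.exists_invariant
  rw [integrableOn_congr_fun_ae (ae_restrict_of_ae hg),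
    integrableOn_congr_fun_ae (ae_restrict_of_ae hg)]
  exact hΩ.integrableOn_iff hD hinv

theorem PeriodicAE.setIntegral_eq [NormedSpace ℝ E] {f : Plane → E} (hf : PeriodicAE L f)
    (hΩ : IsAddFundamentalDomain L Ω (volume : Measure Plane))
    (hD : IsAddFundamentalDomain L D (volume : Measure Plane)) :
    ∫ z in Ω, f z = ∫ z in D, f z := by
  obtain ⟨g, hg, hinv⟩ := hf.exists_invariant
  rw [setIntegral_congr_ae₀ hΩ.nullMeasurableSet (hg.mono fun z hz _ => hz),
    setIntegral_congr_ae₀ hD.nullMeasurableSet (hg.mono fun z hz _ => hz)]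
  exact hΩ.setIntegral_eq hD hinv

theorem PeriodicAE.ae_eq_zero {f : Plane → E} (hf : PeriodicAE L f)
    (hΩ : IsAddFundamentalDomain L Ω (volume : Measure Plane))
    (h : ∀ᵐ z ∂(volume.restrict Ω), f z = 0) : f =ᵐ[volume] 0 := by
  obtain ⟨g, hg, hinv⟩ := hf.exists_invariant
  have h0 : volume {z | g z ≠ 0} = 0 := by
    refine hΩ.measure_zero_of_invariant _ (fun v => ?_) ?_
    · ext z
      rw [mem_vadd_set_iff_neg_vadd_mem]
      simp [hinv]
    · have h1 : ∀ᵐ z, z ∈ Ω → g z = 0 := by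
        filter_upwards [(ae_restrict_iff'₀ hΩ.nullMeasurableSet).1 h, hg] with z h1 h2 hz
        rw [← h2, h1 hz]
      refine measure_mono_null (fun z hz => ?_) (ae_iff.1 h1)
      exact fun hh => hz.1 (hh hz.2)
  exact hg.trans (ae_iff.2 h0)

theorem PeriodicAE.setIntegral_add_right [NormedSpace ℝ E] {f : Plane → E}
    (hf : PeriodicAE L f) (hΩ : IsAddFundamentalDomain L Ω (volume : Measure Plane))
    (hD : IsAddFundamentalDomain L D (volume : Measure Plane)) (w : Plane) :
    ∫ z in D, f (w + z) = ∫ z in Ω, f z := by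
  rw [hf.setIntegral_eq hΩ (hD.vadd_of_comm w)]
  exact ((measurePreserving_vadd w (volume : Measure Plane)).setIntegral_image_emb
    (measurableEmbedding_const_vadd w) f D).symm

end

end

section

open scoped Pointwise

/-! ### The divergence theorem on the torus, in weak form -/

section

variable {L : Submodule ℤ Plane} [Countable L] {Ω D : Set Plane}

/-- The average over a bounded fundamental domain `D` of the translates by `w ∈ D` of an integral
against `ρ`. -/
theorem PeriodicAE.integrable_and_setIntegral_integral {f : Plane → ℝ} (hf : PeriodicAE L f)
    (hfl : LocallyIntegrable f) (hΩ : IsAddFundamentalDomain L Ω (volume : Measure Plane))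
    (hD : IsAddFundamentalDomain L D (volume : Measure Plane)) (hDb : Bornology.IsBounded D)
    {ρ : Plane → ℝ} (hρ : Continuous ρ) (hc : HasCompactSupport ρ) :
    IntegrableOn (fun w => ∫ z, ρ z * f (z + w)) D ∧
      ∫ w in D, ∫ z, ρ z * f (z + w) = (∫ z, ρ z) * ∫ z in Ω, f z := by
  have hm : AEStronglyMeasurable (fun p : Plane × Plane => ρ p.2 * f (p.2 + p.1))
      ((volume.restrict D).prod volume) := by
    refine (hρ.comp continuous_snd).aestronglyMeasurable.mul ?_
    have h1 : AEStronglyMeasurable (fun p : Plane × Plane => f (p.1 + p.2))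
        ((volume : Measure Plane).prod (volume.restrict D)) :=
      hfl.aestronglyMeasurable.comp_quasiMeasurePreserving
        (QuasiMeasurePreserving.prod_of_left measurable_add (Eventually.of_forall fun w =>
          (measurePreserving_add_right volume w).quasiMeasurePreserving))
    exact h1.prod_swap
  have hDi : ∀ {g : Plane → ℝ}, LocallyIntegrable g → IntegrableOn g D := fun hg =>
    (locallyIntegrable_iff.1 hg _ hDb.isCompact_closure).mono_set subset_closure
  have htr : ∀ z, IntegrableOn (fun w => f (z + w)) D := fun z => by
    have h1 : IntegrableOn f (z +ᵥ D) :=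
      (locallyIntegrable_iff.1 hfl _ (hDb.vadd z).isCompact_closure).mono_set subset_closure
    exact ((measurePreserving_vadd z (volume : Measure Plane)).integrableOn_image
      (measurableEmbedding_const_vadd z)).1 h1
  have hint : Integrable (fun p : Plane × Plane => ρ p.2 * f (p.2 + p.1))
      ((volume.restrict D).prod volume) := by
    refine (integrable_prod_iff' hm).2 ⟨Eventually.of_forall fun z => (htr z).const_mul (ρ z), ?_⟩
    have e : ∀ z, ∫ w in D, ‖ρ z * f (z + w)‖ = ‖ρ z‖ * ∫ z in Ω, ‖f z‖ := fun z => by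
      simp only [norm_mul]
      rw [integral_const_mul, (hf.map fun x => ‖x‖).setIntegral_add_right hΩ hD]
    simp only [e]
    exact (hρ.integrable_of_hasCompactSupport hc).norm.mul_const _
  refine ⟨hint.integral_prod_left, ?_⟩
  rw [integral_integral_swap hint]
  have e : ∀ z, ∫ w in D, ρ z * f (z + w) = ρ z * ∫ z in Ω, f z := fun z => by
    rw [integral_const_mul, hf.setIntegral_add_right hΩ hD]
  simp only [e]
  rw [integral_mul_const]

theorem exists_test_function_integral_eq_one :
    ∃ ρ : Plane → ℝ, ContDiff ℝ ∞ ρ ∧ HasCompactSupport ρ ∧ ∫ z, ρ z = 1 := by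
  let φ : ContDiffBump (0 : Plane) := ⟨1, 2, one_pos, one_lt_two⟩
  exact ⟨φ.normed volume, φ.contDiff_normed, φ.hasCompactSupport_normed, φ.integral_normed⟩

theorem integral_translate_eq (ρ f : Plane → ℝ) (w : Plane) :
    ∫ z, ρ (z - w) * f z = ∫ z, ρ z * f (z + w) := by
  rw [← integral_add_right_eq_self _ w]
  simp

/-- The weak divergence `f` of a periodic vector field `(J₁, J₂)` has mean zero: test the equation
with the translates by `w` of a function with integral one, and average over `w`. -/
theorem setIntegral_eq_zero_of_weak_div {f J₁ J₂ : Plane → ℝ} (hf : PeriodicAE L f)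
    (h₁ : PeriodicAE L J₁) (h₂ : PeriodicAE L J₂) (hfl : LocallyIntegrable f)
    (hl₁ : LocallyIntegrable J₁) (hl₂ : LocallyIntegrable J₂)
    (hΩ : IsAddFundamentalDomain L Ω (volume : Measure Plane))
    (hD : IsAddFundamentalDomain L D (volume : Measure Plane)) (hDb : Bornology.IsBounded D)
    (h : ∀ φ : Plane → ℝ, ContDiff ℝ ∞ φ → HasCompactSupport φ →
      ∫ z, φ z * f z
        = (∫ z, fderiv ℝ φ z (1, 0) * J₁ z) + ∫ z, fderiv ℝ φ z (0, 1) * J₂ z) :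
    ∫ z in Ω, f z = 0 := by
  obtain ⟨ρ, hρ, hc, hρ1⟩ := exists_test_function_integral_eq_one
  have hρe := fun e => (contDiff_fderiv_apply hρ e).continuous
  have hce := hasCompactSupport_fderiv_apply hc
  have hw : ∀ w, ∫ z, ρ z * f (z + w) = (∫ z, fderiv ℝ ρ z (1, 0) * J₁ (z + w))
      + ∫ z, fderiv ℝ ρ z (0, 1) * J₂ (z + w) := fun w => by
    have key := h (fun z => ρ (z - w)) (hρ.comp (contDiff_id.sub contDiff_const))
      (hc.comp_homeomorph (Homeomorph.subRight w))
    simp only [fderiv_comp_sub] at key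
    rw [integral_translate_eq, integral_translate_eq (fun z => fderiv ℝ ρ z (1, 0)),
      integral_translate_eq (fun z => fderiv ℝ ρ z (0, 1))] at key
    exact key
  have a₀ := hf.integrable_and_setIntegral_integral hfl hΩ hD hDb hρ.continuous hc
  have a₁ := h₁.integrable_and_setIntegral_integral hl₁ hΩ hD hDb (hρe (1, 0)) (hce (1, 0))
  have a₂ := h₂.integrable_and_setIntegral_integral hl₂ hΩ hD hDb (hρe (0, 1)) (hce (0, 1))
  have e := a₀.2
  simp only [hw] at e
  rw [integral_add a₁.1 a₂.1, a₁.2, a₂.2, integral_fderiv_eq_zero hρ hc,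
    integral_fderiv_eq_zero hρ hc, hρ1] at e
  linarith

/-- A periodic function of mean zero with vanishing weak derivatives is zero. -/
theorem PeriodicAE.ae_eq_zero_of_hasWeakDeriv_zero {f : Plane → ℝ} (hf : PeriodicAE L f)
    (hΩ : IsAddFundamentalDomain L Ω (volume : Measure Plane)) (hΩ0 : volume Ω = 1)
    (hD : IsAddFundamentalDomain L D (volume : Measure Plane)) (hDb : Bornology.IsBounded D)
    (h₁ : HasWeakDeriv (1, 0) f 0) (h₂ : HasWeakDeriv (0, 1) f 0) (hmean : ∫ z in Ω, f z = 0) :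
    f =ᵐ[volume] 0 := by
  have hz : ∀ᵐ z : Plane, f z = 0 := by
    refine ae_eq_zero_of_integral_contDiff_smul_eq_zero h₁.1 fun ρ hρ hc => ?_
    -- the integrals against the translates of `ρ` form a convolution with zero derivative
    set g : Plane → ℝ := fun w => ∫ z, ρ z * f (z + w) with hg
    let σ : Plane → ℝ := fun z => ρ (-z)
    have hσ : ContDiff ℝ ∞ σ := hρ.comp contDiff_neg
    have hσc : HasCompactSupport σ := hc.comp_homeomorph (Homeomorph.neg Plane)
    have hgσ : g = convolution σ f (ContinuousLinearMap.lsmul ℝ ℝ) volume := by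
      ext w
      rw [convolution_eq_swap]
      simp only [hg, ContinuousLinearMap.lsmul_apply, smul_eq_mul, σ, neg_sub]
      exact (integral_translate_eq ρ f w).symm
    have hd : ∀ w, fderiv ℝ g w = 0 := fun w => by
      have d₁ := h₁.fderiv_convolution hσ hσc w
      have d₂ := h₂.fderiv_convolution hσ hσc w
      rw [← hgσ, convolution_zero, Pi.zero_apply] at d₁ d₂
      have := norm_le_of_prod (fderiv ℝ g w)
      rw [d₁, d₂, norm_zero, add_zero] at this
      exact norm_le_zero_iff.1 this
    have hgd : Differentiable ℝ g := by
      rw [hgσ]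
      exact (hσc.contDiff_convolution_left (n := ⊤) _ hσ h₁.1).differentiable (by simp)
    have hconst : ∀ w, g w = g 0 := fun w => is_const_of_fderiv_eq_zero hgd hd w 0
    have avg := (hf.integrable_and_setIntegral_integral h₁.1 hΩ hD hDb hρ.continuous hc).2
    change ∫ w in D, g w = _ at avg
    have hDv : volume.real D = 1 := by
      rw [measureReal_def, ← hΩ.measure_eq hD, hΩ0, ENNReal.toReal_one]
    simp only [hconst] at avg
    rw [setIntegral_const, hmean, hDv, mul_zero, one_smul] at avg
    simpa [hg] using avg
  exact hz

end

end

section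

variable {L : Submodule ℤ Plane} {Ω D : Set Plane}

/-! ### The Bogomolny identity on the torus -/

theorem PeriodicAE.weakDeriv {F : Type*} [NormedAddCommGroup F] [NormedSpace ℝ F]
    [CompleteSpace F] {e : Plane} {f g : Plane → F} (hf : PeriodicAE L f)
    (h : HasWeakDeriv e f g) : PeriodicAE L g := fun v hv =>
  ((h.translate v).congr (hf v hv) EventuallyEq.rfl).ae_eq h

/-- The integral identity behind the Bogomolny bound, for a gauge field whose gauge invariant
quantities are periodic. -/
theorem setIntegral_bogomolny_eq_zero [Countable L]
    (hΩ : IsAddFundamentalDomain L Ω (volume : Measure Plane))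
    (hD : IsAddFundamentalDomain L D (volume : Measure Plane)) (hDb : Bornology.IsBounded D)
    {u : Plane → ℂ} {A₁ A₂ : Plane → ℝ} (hu : H1Loc u) (hA₁ : H1Loc A₁) (hA₂ : H1Loc A₂)
    (pN : PeriodicAE L fun z => (inner ℝ (u z) (u z) : ℝ))
    (pB : PeriodicAE L fun z => dx A₂ z - dy A₁ z)
    (pXY : PeriodicAE L fun z =>
      (inner ℝ (Complex.I * cov A₁ u (dx u) z) (cov A₂ u (dy u) z) : ℝ))
    (pX : PeriodicAE L fun z => (inner ℝ (u z) (cov A₁ u (dx u) z) : ℝ))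
    (pY : PeriodicAE L fun z => (inner ℝ (u z) (cov A₂ u (dy u) z) : ℝ)) :
    IntegrableOn (fun z => 2 * inner ℝ (Complex.I * cov A₁ u (dx u) z) (cov A₂ u (dy u) z)
        - (dx A₂ z - dy A₁ z) * inner ℝ (u z) (u z)) Ω ∧
      ∫ z in Ω, (2 * inner ℝ (Complex.I * cov A₁ u (dx u) z) (cov A₂ u (dy u) z)
        - (dx A₂ z - dy A₁ z) * inner ℝ (u z) (u z)) = 0 := by
  have hX : L2Loc (cov A₁ u (dx u)) := hA₁.l2Loc_cov hu hu.l2Loc_dx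
  have hY : L2Loc (cov A₂ u (dy u)) := hA₂.l2Loc_cov hu hu.l2Loc_dy
  have hB : L2Loc fun z => dx A₂ z - dy A₁ z := fun K hK =>
    (hA₂.l2Loc_dx K hK).sub (hA₁.l2Loc_dy K hK)
  have hIX : L2Loc fun z => Complex.I * cov A₁ u (dx u) z :=
    hX.clm (ContinuousLinearMap.mul ℝ ℂ Complex.I)
  have lf : LocallyIntegrable fun z => 2 * inner ℝ (Complex.I * cov A₁ u (dx u) z)
      (cov A₂ u (dy u) z) - (dx A₂ z - dy A₁ z) * inner ℝ (u z) (u z) :=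
    ((hIX.locallyIntegrable_inner hY).clm (ContinuousLinearMap.mul ℝ ℝ 2)).sub
      (hB.locallyIntegrable_mul hu.l2Loc_inner_self)
  have lX := hu.1.locallyIntegrable_inner hX
  have lY := hu.1.locallyIntegrable_inner hY
  have pf : PeriodicAE L fun z => 2 * inner ℝ (Complex.I * cov A₁ u (dx u) z)
      (cov A₂ u (dy u) z) - (dx A₂ z - dy A₁ z) * inner ℝ (u z) (u z) :=
    (pXY.map fun x => 2 * x).map₂ (pB.map₂ pN fun x y => x * y) fun x y => x - y
  refine ⟨(pf.integrableOn_iff hΩ hD).2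
    ((locallyIntegrable_iff.1 lf _ hDb.isCompact_closure).mono_set subset_closure), ?_⟩
  refine setIntegral_eq_zero_of_weak_div pf pY (pX.map fun x => -x) lf lY lX.neg hΩ hD hDb
    fun φ hφ hc => ?_
  have hφe := fun e => (contDiff_fderiv_apply hφ e).continuous
  have hce := hasCompactSupport_fderiv_apply hc
  have key := integral_bogomolnyIntegrand hu hA₁ hA₂ hφ hc
  have i₀ := integrable_smul_of_testFunction lf hφ.continuous hc
  have i₁ := integrable_smul_of_testFunction lY (hφe (1, 0)) (hce (1, 0))
  have i₂ := integrable_smul_of_testFunction lX (hφe (0, 1)) (hce (0, 1))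
  simp only [smul_eq_mul] at i₀ i₁ i₂
  simp only [bogomolnyIntegrand] at key
  replace key := (integral_sub i₀ (i₁.sub i₂)).symm.trans key
  rw [integral_sub' i₁ i₂] at key
  simp only [mul_neg, integral_neg]
  linarith

/-! ### Gauge covariance -/

/-- Leibniz rule for the product with a smooth complex function. -/
theorem HasWeakDeriv.complex_mul {e : Plane} {f g : Plane → ℂ} (h : HasWeakDeriv e f g)
    {η : Plane → ℂ} (hη : ContDiff ℝ ∞ η) :
    HasWeakDeriv e (fun z => η z * f z) (fun z => η z * g z + fderiv ℝ η z e * f z) := by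
  have hr : ContDiff ℝ ∞ fun z => (η z).re := Complex.reCLM.contDiff.comp hη
  have hi : ContDiff ℝ ∞ fun z => (η z).im := Complex.imCLM.contDiff.comp hη
  have hd := fun z => (hη.differentiable (by simp) z).hasFDerivAt
  have er : ∀ z, fderiv ℝ (fun z => (η z).re) z e = (fderiv ℝ η z e).re := fun z =>
    congrArg (fun T : Plane →L[ℝ] ℝ => T e) (Complex.reCLM.hasFDerivAt.comp z (hd z)).fderiv
  have ei : ∀ z, fderiv ℝ (fun z => (η z).im) z e = (fderiv ℝ η z e).im := fun z =>
    congrArg (fun T : Plane →L[ℝ] ℝ => T e) (Complex.imCLM.hasFDerivAt.comp z (hd z)).fderiv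
  have hI := h.clm (ContinuousLinearMap.mul ℝ ℂ Complex.I)
  have hsplit : ∀ x y : ℂ, x * y = x.re • y + x.im • (Complex.I * y) := fun x y => by
    conv_lhs => rw [← Complex.re_add_im x]
    rw [Complex.real_smul, Complex.real_smul]
    ring
  refine ((h.smul hr).add (hI.smul hi)).congr (Eventually.of_forall fun z => ?_)
    (Eventually.of_forall fun z => ?_)
  · exact (hsplit _ _).symm
  · simp only [er, ei, ContinuousLinearMap.mul_apply']
    rw [hsplit (η z), hsplit (fderiv ℝ η z e)]
    abel

/-- The multiplier `exp (iπ (v_x y - v_y x))` of the line bundle. -/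
def multiplier (v z : Plane) : ℂ :=
  Complex.exp (Complex.I * Real.pi * ((v.1 * z.2 - v.2 * z.1 : ℝ) : ℂ))

theorem norm_multiplier (v z : Plane) : ‖multiplier v z‖ = 1 := by
  rw [multiplier, Complex.norm_exp]
  simp

theorem contDiff_multiplier (v : Plane) : ContDiff ℝ ∞ (multiplier v) := by
  have h : ContDiff ℝ ∞ fun z : Plane => v.1 * z.2 - v.2 * z.1 := by fun_prop
  exact Complex.contDiff_exp.comp (contDiff_const.mul (Complex.ofRealCLM.contDiff.comp h))

theorem fderiv_multiplier (v z e : Plane) : fderiv ℝ (multiplier v) z e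
    = Complex.I * Real.pi * ((v.1 * e.2 - v.2 * e.1 : ℝ) : ℂ) * multiplier v z := by
  let T : Plane →L[ℝ] ℝ :=
    v.1 • ContinuousLinearMap.snd ℝ ℝ ℝ - v.2 • ContinuousLinearMap.fst ℝ ℝ ℝ
  have h : HasFDerivAt (multiplier v) _ z :=
    (((Complex.ofRealCLM.comp T).hasFDerivAt (x := z)).const_mul
      (Complex.I * (Real.pi : ℂ))).cexp
  rw [h.fderiv]
  simp [T, multiplier]
  ring

theorem inner_mul_of_norm_eq_one {c : ℂ} (hc : ‖c‖ = 1) (x y : ℂ) :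
    (inner ℝ (c * x) (c * y) : ℝ) = inner ℝ x y := by
  have h : c * (starRingEnd ℂ) c = 1 := by
    rw [Complex.mul_conj', hc]; simp
  rw [Complex.inner, Complex.inner, map_mul, mul_mul_mul_comm, h, one_mul]

/-- Translation by a lattice vector `v` multiplies a section by the multiplier, and its weak
derivative changes by the derivative of the phase. -/
theorem weakDeriv_translate {e v : Plane} {u g : Plane → ℂ} (h : HasWeakDeriv e u g)
    (hv : ∀ᵐ z : Plane, u (z + v) = multiplier v z * u z) :
    ∀ᵐ z : Plane, g (z + v) = multiplier v z *
      (g z + Complex.I * Real.pi * ((v.1 * e.2 - v.2 * e.1 : ℝ) : ℂ) * u z) := by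
  have h1 := ((h.translate v).congr hv EventuallyEq.rfl).ae_eq
    (h.complex_mul (contDiff_multiplier v))
  filter_upwards [h1] with z hz
  rw [hz, fderiv_multiplier]
  ring

end

section

variable {L : Submodule ℤ Plane} {Ω D : Set Plane}

/-- Under translation by a lattice vector, a section and its covariant derivatives are multiplied by
the same phase. -/
theorem ae_translate_cov {b : Module.Basis (Fin 2) ℤ L} {u : Plane → ℂ} {a : Plane → Plane}
    (hu : IsSection b u) (ha : ∀ v ∈ L, ∀ᵐ z : Plane, a (z + v) = a z) (j : Fin 2) :
    ∀ᵐ z : Plane, u (z + b j) = multiplier (b j) z * u z ∧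
      cov (fun w => (A0 w).1 + (a w).1) u (dx u) (z + b j)
        = multiplier (b j) z * cov (fun w => (A0 w).1 + (a w).1) u (dx u) z ∧
      cov (fun w => (A0 w).2 + (a w).2) u (dy u) (z + b j)
        = multiplier (b j) z * cov (fun w => (A0 w).2 + (a w).2) u (dy u) z := by
  filter_upwards [hu.2 j, weakDeriv_translate hu.1.hasWeakDeriv_dx (hu.2 j),
    weakDeriv_translate hu.1.hasWeakDeriv_dy (hu.2 j), ha _ (b j).2] with z h0 h1 h2 h3
  change u (z + b j) = multiplier (b j) z * u z at h0
  refine ⟨h0, ?_, ?_⟩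
  · simp only [cov, h0, h1, h3, A0, Prod.fst_add, Prod.snd_add]
    push_cast
    linear_combination (-(Real.pi : ℂ) * (b j : Plane).2 * multiplier (b j) z * u z) * Complex.I_sq
  · simp only [cov, h0, h2, h3, A0, Prod.fst_add, Prod.snd_add]
    push_cast
    linear_combination ((Real.pi : ℂ) * (b j : Plane).1 * multiplier (b j) z * u z) * Complex.I_sq

theorem contDiff_A0_fst : ContDiff ℝ ∞ fun z => (A0 z).1 := by
  unfold A0; fun_prop

theorem contDiff_A0_snd : ContDiff ℝ ∞ fun z => (A0 z).2 := by
  unfold A0; fun_prop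

/-- The background potential contributes the constant `2π` to the magnetic field. -/
theorem curl_A0_add {a : Plane → Plane} (h₁ : H1Loc fun z => (a z).1)
    (h₂ : H1Loc fun z => (a z).2) :
    ∀ᵐ z : Plane, dx (fun w => (A0 w).2 + (a w).2) z - dy (fun w => (A0 w).1 + (a w).1) z
      = 2 * Real.pi + curl a z := by
  have e₂ := ((hasWeakDeriv_of_contDiff (1, 0) contDiff_A0_snd).add h₂.hasWeakDeriv_dx).dx_ae_eq
  have e₁ := ((hasWeakDeriv_of_contDiff (0, 1) contDiff_A0_fst).add h₁.hasWeakDeriv_dy).dy_ae_eq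
  have f₂ : ∀ z, fderiv ℝ (fun z => (A0 z).2) z (1, 0) = Real.pi := fun z => by
    have h : HasFDerivAt (fun z : Plane => (A0 z).2) _ z :=
      ((ContinuousLinearMap.fst ℝ ℝ ℝ).hasFDerivAt (x := z)).const_mul Real.pi
    rw [h.fderiv]; simp
  have f₁ : ∀ z, fderiv ℝ (fun z => (A0 z).1) z (0, 1) = -Real.pi := fun z => by
    have h : HasFDerivAt (fun z : Plane => (A0 z).1) _ z :=
      (((ContinuousLinearMap.snd ℝ ℝ ℝ).hasFDerivAt (x := z)).const_mul Real.pi).neg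
    rw [h.fderiv]; simp
  filter_upwards [e₁, e₂] with z h1 h2
  rw [h1, h2, f₁, f₂, curl]
  ring

/-! ### Vector potentials -/

theorem IsPotential.l2Loc_curl {a : Plane → Plane} (ha : IsPotential L Ω a) : L2Loc (curl a) :=
  fun K hK => (ha.2.1.l2Loc_dx K hK).sub (ha.1.l2Loc_dy K hK)

theorem IsPotential.periodicAE {a : Plane → Plane} (ha : IsPotential L Ω a) : PeriodicAE L a :=
  ha.2.2.2.1

theorem IsPotential.periodicAE_curl {a : Plane → Plane} (ha : IsPotential L Ω a) :
    PeriodicAE L (curl a) :=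
  ((ha.periodicAE.map Prod.snd).weakDeriv ha.2.1.hasWeakDeriv_dx).map₂
    ((ha.periodicAE.map Prod.fst).weakDeriv ha.1.hasWeakDeriv_dy) fun x y => x - y

section

variable [Countable L]

theorem PeriodicAE.integrableOn {f : Plane → ℝ} (hf : PeriodicAE L f)
    (hΩ : IsAddFundamentalDomain L Ω (volume : Measure Plane))
    (hD : IsAddFundamentalDomain L D (volume : Measure Plane)) (hDb : Bornology.IsBounded D)
    (hfl : LocallyIntegrable f) : IntegrableOn f Ω :=
  (hf.integrableOn_iff hΩ hD).2
    ((locallyIntegrable_iff.1 hfl _ hDb.isCompact_closure).mono_set subset_closure)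

/-- The flux of `curl a` through the torus vanishes. -/
theorem IsPotential.setIntegral_curl {a : Plane → Plane} (ha : IsPotential L Ω a)
    (hΩ : IsAddFundamentalDomain L Ω (volume : Measure Plane))
    (hD : IsAddFundamentalDomain L D (volume : Measure Plane)) (hDb : Bornology.IsBounded D) :
    ∫ z in Ω, curl a z = 0 := by
  refine setIntegral_eq_zero_of_weak_div ha.periodicAE_curl
    ((ha.periodicAE.map Prod.snd).map fun x => -x) (ha.periodicAE.map Prod.fst)
    ha.l2Loc_curl.locallyIntegrable ha.2.1.1.locallyIntegrable.neg ha.1.1.locallyIntegrable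
    hΩ hD hDb fun φ hφ hc => ?_
  have e₂ := ha.2.1.hasWeakDeriv_dx.2.2 φ hφ hc
  have e₁ := ha.1.hasWeakDeriv_dy.2.2 φ hφ hc
  have i₂ := integrable_smul_of_testFunction ha.2.1.l2Loc_dx.locallyIntegrable hφ.continuous hc
  have i₁ := integrable_smul_of_testFunction ha.1.l2Loc_dy.locallyIntegrable hφ.continuous hc
  simp only [smul_eq_mul] at e₁ e₂ i₁ i₂
  simp only [curl, mul_sub, mul_neg, integral_neg]
  rw [integral_sub i₂ i₁, e₁, e₂]
  ring

/-- A vector potential with `curl a = 0` vanishes: by the Bogomolny identity for the function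
`a_x + i a_y` without a gauge field, its Jacobian has mean zero. As `div a = curl a = 0`, the Jacobian
is `-(∂ₓ a_x)² - (∂ₓ a_y)²`, so that `a` has zero weak derivatives, and its mean is zero. -/
theorem IsPotential.ae_eq_zero {a : Plane → Plane} (ha : IsPotential L Ω a)
    (hΩ : IsAddFundamentalDomain L Ω (volume : Measure Plane)) (hΩ1 : volume Ω = 1)
    (hD : IsAddFundamentalDomain L D (volume : Measure Plane)) (hDb : Bornology.IsBounded D)
    (hcurl : curl a =ᵐ[volume] 0) : a =ᵐ[volume] 0 := by
  set p := dx fun z => (a z).1 with hp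
  set q := dx fun z => (a z).2 with hq
  set r := dy fun z => (a z).1 with hr
  set s := dy fun z => (a z).2 with hs
  let I' : ℝ →L[ℝ] ℂ := (ContinuousLinearMap.mul ℝ ℂ Complex.I).comp Complex.ofRealCLM
  let w : Plane → ℂ := fun z => Complex.ofRealCLM (a z).1 + I' (a z).2
  have hw : H1Loc w := (ha.1.clm Complex.ofRealCLM).add (ha.2.1.clm I')
  have hwx : dx w =ᵐ[volume] fun z => Complex.ofRealCLM (p z) + I' (q z) :=
    ((ha.1.hasWeakDeriv_dx.clm Complex.ofRealCLM).add (ha.2.1.hasWeakDeriv_dx.clm I')).dx_ae_eq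
  have hwy : dy w =ᵐ[volume] fun z => Complex.ofRealCLM (r z) + I' (s z) :=
    ((ha.1.hasWeakDeriv_dy.clm Complex.ofRealCLM).add (ha.2.1.hasWeakDeriv_dy.clm I')).dy_ae_eq
  have pw : PeriodicAE L w :=
    (ha.periodicAE.map fun x => Complex.ofRealCLM x.1 + I' x.2)
  have pwx := pw.weakDeriv hw.hasWeakDeriv_dx
  have pwy := pw.weakDeriv hw.hasWeakDeriv_dy
  have hA : H1Loc (fun _ : Plane => (0 : ℝ)) := h1Loc_of_contDiff contDiff_const
  have p0 : PeriodicAE L (fun _ : Plane => (0 : ℝ)) := fun v _ => by simp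
  have pX : PeriodicAE L (cov (fun _ => 0) w (dx w)) :=
    pwx.map₂ pw fun x y => Complex.I * x + ((0 : ℝ) : ℂ) * y
  have pY : PeriodicAE L (cov (fun _ => 0) w (dy w)) :=
    pwy.map₂ pw fun x y => Complex.I * x + ((0 : ℝ) : ℂ) * y
  have key := (setIntegral_bogomolny_eq_zero hΩ hD hDb hw hA hA (pw.map fun x => inner ℝ x x)
    ((p0.weakDeriv hA.hasWeakDeriv_dx).map₂ (p0.weakDeriv hA.hasWeakDeriv_dy) fun x y => x - y)
    (pX.map₂ pY fun x y => inner ℝ (Complex.I * x) y) (pw.map₂ pX fun x y => inner ℝ x y)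
    (pw.map₂ pY fun x y => inner ℝ x y)).2
  have h0x : dx (fun _ : Plane => (0 : ℝ)) =ᵐ[volume] 0 :=
    ((hasWeakDeriv_of_contDiff (1, 0) (contDiff_const (c := (0 : ℝ)))).dx_ae_eq).trans
      (Eventually.of_forall fun z => by simp)
  have h0y : dy (fun _ : Plane => (0 : ℝ)) =ᵐ[volume] 0 :=
    ((hasWeakDeriv_of_contDiff (0, 1) (contDiff_const (c := (0 : ℝ)))).dy_ae_eq).trans
      (Eventually.of_forall fun z => by simp)
  have hdiv : ∀ᵐ z, s z = -p z := ha.2.2.1.mono fun z hz => by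
    simp only [div] at hz
    linarith
  have hcurl' : ∀ᵐ z, r z = q z := hcurl.mono fun z hz => by
    simp only [curl, Pi.zero_apply] at hz
    linarith
  have e : ∀ᵐ z, 2 * inner ℝ (Complex.I * cov (fun _ => 0) w (dx w) z)
      (cov (fun _ => 0) w (dy w) z) - (dx (fun _ : Plane => (0 : ℝ)) z
        - dy (fun _ : Plane => (0 : ℝ)) z) * inner ℝ (w z) (w z)
      = -(2 * (p z * p z + q z * q z)) := by
    filter_upwards [hwx, hwy, h0x, h0y, hdiv, hcurl'] with z h1 h2 h3 h4 h5 h6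
    simp only [cov, h1, h2, h3, h4, h5, h6, I', Complex.inner]
    simp
    ring
  rw [integral_congr_ae (ae_restrict_of_ae e), integral_neg, integral_const_mul] at key
  have pp : PeriodicAE L p := (ha.periodicAE.map Prod.fst).weakDeriv ha.1.hasWeakDeriv_dx
  have pq : PeriodicAE L q := (ha.periodicAE.map Prod.snd).weakDeriv ha.2.1.hasWeakDeriv_dx
  have hpq : ∀ᵐ z ∂(volume.restrict Ω), p z * p z + q z * q z = 0 := by
    have hint : IntegrableOn (fun z => p z * p z + q z * q z) Ω :=
      ((pp.map fun x => x * x).map₂ (pq.map fun x => x * x) fun x y => x + y).integrableOn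
        hΩ hD hDb ((ha.1.l2Loc_dx.locallyIntegrable_mul ha.1.l2Loc_dx).add
          (ha.2.1.l2Loc_dx.locallyIntegrable_mul ha.2.1.l2Loc_dx))
    exact (integral_eq_zero_iff_of_nonneg
      (fun z => add_nonneg (mul_self_nonneg _) (mul_self_nonneg _)) hint).1 (by linarith)
  have hp0 : p =ᵐ[volume] 0 := pp.ae_eq_zero hΩ (hpq.mono fun z hz => by
    nlinarith [mul_self_nonneg (p z), mul_self_nonneg (q z)])
  have hq0 : q =ᵐ[volume] 0 := pq.ae_eq_zero hΩ (hpq.mono fun z hz => by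
    nlinarith [mul_self_nonneg (p z), mul_self_nonneg (q z)])
  have hr0 : r =ᵐ[volume] 0 := by
    filter_upwards [hcurl', hq0] with z h1 h2
    rw [h1, h2]
  have hs0 : s =ᵐ[volume] 0 := by
    filter_upwards [hdiv, hp0] with z h1 h2
    rw [h1, h2]; simp
  have z₁ := (ha.periodicAE.map Prod.fst).ae_eq_zero_of_hasWeakDeriv_zero hΩ hΩ1 hD hDb
    (ha.1.hasWeakDeriv_dx.congr EventuallyEq.rfl hp0)
    (ha.1.hasWeakDeriv_dy.congr EventuallyEq.rfl hr0) ha.2.2.2.2.1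
  have z₂ := (ha.periodicAE.map Prod.snd).ae_eq_zero_of_hasWeakDeriv_zero hΩ hΩ1 hD hDb
    (ha.2.1.hasWeakDeriv_dx.congr EventuallyEq.rfl hq0)
    (ha.2.1.hasWeakDeriv_dy.congr EventuallyEq.rfl hs0) ha.2.2.2.2.2
  filter_upwards [z₁, z₂] with z h1 h2
  exact Prod.ext h1 h2

/-! ### The lower bound for the energy -/

/-- Pointwise lower bound for the energy density; `X`, `Y` are the components of the covariant
derivative, `N = |u|²` and `h = curl a`. -/
theorem quarter_add_le_density {k Hint : ℝ} (hk : 1 / Real.sqrt 2 ≤ k) (hH : k ≤ Hint) (X Y : ℂ)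
    {N : ℝ} (hN : 0 ≤ N) (h : ℝ) :
    1 / 4 + (mu k Hint / 2 * (2 * inner ℝ (Complex.I * X) Y - (2 * Real.pi + h) * N)
        + 1 / 4 * ((N + mu k Hint * h) * (N + mu k Hint * h)))
      ≤ mu k Hint / 2 * (‖X‖ ^ 2 + ‖Y‖ ^ 2) + 1 / 4 * (1 - N) ^ 2
        + mu k Hint ^ 2 * k ^ 2 / 2 * |h| ^ 2 := by
  have hk0 : 0 < k := lt_of_lt_of_le (by positivity) hk
  have hk2 : 1 / 2 ≤ k ^ 2 := by
    have := pow_le_pow_left₀ (by positivity) hk 2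
    rwa [div_pow, Real.sq_sqrt (by norm_num), one_pow] at this
  have hmu : 1 / 2 ≤ mu k Hint * Real.pi := by
    have e : mu k Hint * Real.pi = Hint / k / 2 := by
      rw [mu]; field_simp
    have := (one_le_div hk0).2 hH
    rw [e]; linarith
  have hmu0 : 0 ≤ mu k Hint := by
    rw [mu]; have := hk0.le.trans hH; positivity
  have hin : 2 * inner ℝ (Complex.I * X) Y ≤ ‖X‖ ^ 2 + ‖Y‖ ^ 2 := by
    have h1 := real_inner_le_norm (Complex.I * X) Y
    rw [norm_mul, Complex.norm_I, one_mul] at h1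
    nlinarith [sq_nonneg (‖X‖ - ‖Y‖)]
  rw [sq_abs]
  have t1 : mu k Hint / 2 * (2 * inner ℝ (Complex.I * X) Y)
      ≤ mu k Hint / 2 * (‖X‖ ^ 2 + ‖Y‖ ^ 2) := mul_le_mul_of_nonneg_left hin (by positivity)
  have t2 : 0 ≤ (mu k Hint * Real.pi - 1 / 2) * N := mul_nonneg (by linarith) hN
  have t3 : 0 ≤ (mu k Hint * h) ^ 2 * (k ^ 2 - 1 / 2) := mul_nonneg (sq_nonneg _) (by linarith)
  nlinarith [t1, t2, t3]

theorem ofReal_integral_le_lintegral {α : Type*} [MeasurableSpace α] {ν : Measure α} {f : α → ℝ}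
    (hf : Integrable f ν) : ENNReal.ofReal (∫ z, f z ∂ν) ≤ ∫⁻ z, ENNReal.ofReal (f z) ∂ν := by
  rw [integral_eq_lintegral_pos_part_sub_lintegral_neg_part hf]
  refine (ENNReal.ofReal_le_ofReal (sub_le_self _ ENNReal.toReal_nonneg)).trans ?_
  exact ENNReal.ofReal_toReal_le

/-- The energy exceeds `1/4` at least by a quarter of the integral of `(|u|² + μ curl a)²`. The
periodicity of `|u|²` and the integrability of that square are needed again in the case of equality. -/
theorem ofReal_quarter_add_le_energy (b : Module.Basis (Fin 2) ℤ L)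
    (hΩ : IsAddFundamentalDomain L Ω (volume : Measure Plane)) (hΩ1 : volume Ω = 1)
    (hD : IsAddFundamentalDomain L D (volume : Measure Plane)) (hDb : Bornology.IsBounded D)
    {k Hint : ℝ} (hk : 1 / Real.sqrt 2 ≤ k) (hH : k ≤ Hint) {u : Plane → ℂ} {a : Plane → Plane}
    (hu : IsSection b u) (ha : IsPotential L Ω a) :
    PeriodicAE L (fun z => (inner ℝ (u z) (u z) : ℝ)) ∧
    IntegrableOn (fun z => (inner ℝ (u z) (u z) + mu k Hint * curl a z)
        * (inner ℝ (u z) (u z) + mu k Hint * curl a z)) Ω ∧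
      ENNReal.ofReal (1 / 4 + 1 / 4 * ∫ z in Ω, (inner ℝ (u z) (u z) + mu k Hint * curl a z)
        * (inner ℝ (u z) (u z) + mu k Hint * curl a z)) ≤ energy Ω k Hint u a := by
  have hcov := ae_translate_cov hu ha.periodicAE
  have hA₁ : H1Loc fun z => (A0 z).1 + (a z).1 := (h1Loc_of_contDiff contDiff_A0_fst).add ha.1
  have hA₂ : H1Loc fun z => (A0 z).2 + (a z).2 := (h1Loc_of_contDiff contDiff_A0_snd).add ha.2.1
  set X := cov (fun z => (A0 z).1 + (a z).1) u (dx u) with hX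
  set Y := cov (fun z => (A0 z).2 + (a z).2) u (dy u) with hY
  have pN : PeriodicAE L fun z => (inner ℝ (u z) (u z) : ℝ) := periodicAE_of_basis b fun j => by
    filter_upwards [hcov j] with z hz
    rw [hz.1, inner_mul_of_norm_eq_one (norm_multiplier _ _)]
  have pX : PeriodicAE L fun z => (inner ℝ (u z) (X z) : ℝ) := periodicAE_of_basis b fun j => by
    filter_upwards [hcov j] with z hz
    rw [hz.1, hz.2.1, inner_mul_of_norm_eq_one (norm_multiplier _ _)]
  have pY : PeriodicAE L fun z => (inner ℝ (u z) (Y z) : ℝ) := periodicAE_of_basis b fun j => by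
    filter_upwards [hcov j] with z hz
    rw [hz.1, hz.2.2, inner_mul_of_norm_eq_one (norm_multiplier _ _)]
  have pXY : PeriodicAE L fun z => (inner ℝ (Complex.I * X z) (Y z) : ℝ) :=
    periodicAE_of_basis b fun j => by
      filter_upwards [hcov j] with z hz
      rw [hz.2.1, hz.2.2, mul_left_comm, inner_mul_of_norm_eq_one (norm_multiplier _ _)]
  have hB := curl_A0_add ha.1 ha.2.1
  have pB : PeriodicAE L fun z => dx (fun w => (A0 w).2 + (a w).2) z
      - dy (fun w => (A0 w).1 + (a w).1) z :=
    (ha.periodicAE_curl.map fun x => 2 * Real.pi + x).congr (hB.mono fun z hz => hz.symm)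
  obtain ⟨iF, hF⟩ := setIntegral_bogomolny_eq_zero hΩ hD hDb hu.1 hA₁ hA₂ pN pB pXY pX pY
  rw [← hX, ← hY] at iF hF
  have hSl : L2Loc fun z => inner ℝ (u z) (u z) + mu k Hint * curl a z :=
    hu.1.l2Loc_inner_self.add (ha.l2Loc_curl.clm (ContinuousLinearMap.mul ℝ ℝ (mu k Hint)))
  have pS : PeriodicAE L fun z => inner ℝ (u z) (u z) + mu k Hint * curl a z :=
    pN.map₂ ha.periodicAE_curl fun x y => x + mu k Hint * y
  have iS := (pS.map fun x => x * x).integrableOn hΩ hD hDb (hSl.locallyIntegrable_mul hSl)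
  have hfin : IsFiniteMeasure (volume.restrict Ω) := ⟨by simp [hΩ1]⟩
  have i4 : IntegrableOn (fun _ : Plane => (1 / 4 : ℝ)) Ω := integrable_const _
  refine ⟨pN, iS, ?_⟩
  have iG := i4.add ((iF.const_mul (mu k Hint / 2)).add (iS.const_mul (1 / 4)))
  have hG := integral_add' i4 ((iF.const_mul (mu k Hint / 2)).add (iS.const_mul (1 / 4)))
  rw [integral_add' (iF.const_mul (mu k Hint / 2)) (iS.const_mul (1 / 4)), integral_const_mul,
    integral_const_mul, hF, setIntegral_const, measureReal_def, hΩ1, mul_zero, zero_add,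
    ENNReal.toReal_one, one_smul] at hG
  rw [← hG]
  refine (ofReal_integral_le_lintegral iG).trans (lintegral_mono_ae ?_)
  refine ae_restrict_of_ae (hB.mono fun z hz => ENNReal.ofReal_le_ofReal ?_)
  simp only [Pi.add_apply, hz]
  have := quarter_add_le_density hk hH (X z) (Y z) (real_inner_self_nonneg (x := u z)) (curl a z)
  rw [real_inner_self_eq_norm_sq] at this ⊢
  exact this

end

end

variable {L : Submodule ℤ Plane} {Ω D : Set Plane}

/-! ### The normal state -/

theorem hasWeakDeriv_of_ae_eq_zero {F : Type*} [NormedAddCommGroup F] [NormedSpace ℝ F]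
    (e : Plane) {f : Plane → F} (hf : f =ᵐ[volume] 0) : HasWeakDeriv e f 0 :=
  (hasWeakDeriv_of_contDiff e (contDiff_const (c := (0 : F)))).congr hf.symm
    (Eventually.of_forall fun z => by simp)

theorem h1Loc_of_ae_eq_zero {F : Type*} [NormedAddCommGroup F] [NormedSpace ℝ F]
    {f : Plane → F} (hf : f =ᵐ[volume] 0) : H1Loc f := by
  have h0 : L2Loc (0 : Plane → F) := fun K _ => MemLp.zero
  exact ⟨h0.congr hf.symm, ⟨0, h0, hasWeakDeriv_of_ae_eq_zero _ hf⟩,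
    ⟨0, h0, hasWeakDeriv_of_ae_eq_zero _ hf⟩⟩

theorem mem_admissible_of_ae_eq_zero (b : Module.Basis (Fin 2) ℤ L) {u : Plane → ℂ}
    {a : Plane → Plane} (hu : u =ᵐ[volume] 0) (ha : a =ᵐ[volume] 0) : (u, a) ∈ admissible b Ω := by
  have h₁ : (fun z => (a z).1) =ᵐ[volume] 0 := ha.mono fun z hz => by simp [hz]
  have h₂ : (fun z => (a z).2) =ᵐ[volume] 0 := ha.mono fun z hz => by simp [hz]
  refine ⟨⟨h1Loc_of_ae_eq_zero hu, fun j => ?_⟩, h1Loc_of_ae_eq_zero h₁, h1Loc_of_ae_eq_zero h₂,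
    ?_, fun v _ => ?_, ?_, ?_⟩
  · filter_upwards [hu, ae_comp_add hu (b j)] with z h1 h2
    simp [h1, h2]
  · filter_upwards [(hasWeakDeriv_of_ae_eq_zero (1, 0) h₁).dx_ae_eq,
      (hasWeakDeriv_of_ae_eq_zero (0, 1) h₂).dy_ae_eq] with z h1 h2
    simp [div, h1, h2]
  · filter_upwards [ha, ae_comp_add ha v] with z h1 h2
    simp [h1, h2]
  · rw [integral_congr_ae (ae_restrict_of_ae h₁)]; simp
  · rw [integral_congr_ae (ae_restrict_of_ae h₂)]; simp

theorem energy_of_ae_eq_zero (hΩ1 : volume Ω = 1) (k Hint : ℝ) {u : Plane → ℂ}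
    {a : Plane → Plane} (hu : u =ᵐ[volume] 0) (ha : a =ᵐ[volume] 0) :
    energy Ω k Hint u a = 1 / 4 := by
  have h₁ : (fun z => (a z).1) =ᵐ[volume] 0 := ha.mono fun z hz => by simp [hz]
  have h₂ : (fun z => (a z).2) =ᵐ[volume] 0 := ha.mono fun z hz => by simp [hz]
  have e : ∀ᵐ z, ENNReal.ofReal (density k Hint u a z) = 1 / 4 := by
    filter_upwards [hu, (hasWeakDeriv_of_ae_eq_zero (1, 0) hu).dx_ae_eq,
      (hasWeakDeriv_of_ae_eq_zero (0, 1) hu).dy_ae_eq,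
      (hasWeakDeriv_of_ae_eq_zero (1, 0) h₂).dx_ae_eq,
      (hasWeakDeriv_of_ae_eq_zero (0, 1) h₁).dy_ae_eq] with z h0 h1 h2 h3 h4
    have : density k Hint u a z = 1 / 4 := by
      simp [density, covGradSq, curl, h0, h1, h2, h3, h4]
    rw [this, ENNReal.ofReal_div_of_pos (by norm_num)]
    simp
  rw [energy, lintegral_congr_ae (ae_restrict_of_ae e), setLIntegral_const, hΩ1, mul_one]

/-- The parallelogram spanned by a basis of the lattice is a bounded fundamental domain. -/
theorem exists_bounded_fundamentalDomain [DiscreteTopology L] [IsZLattice ℝ L]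
    (b : Module.Basis (Fin 2) ℤ L) :
    ∃ D : Set Plane, IsAddFundamentalDomain L D (volume : Measure Plane) ∧
      Bornology.IsBounded D :=
  ⟨_, ZLattice.isAddFundamentalDomain b volume, ZSpan.fundamentalDomain_isBounded _⟩

end GinzburgLandau

end

open GinzburgLandau in
theorem theorem5 (L : Submodule ℤ GinzburgLandau.Plane) [DiscreteTopology L] [IsZLattice ℝ L]
    (b : Module.Basis (Fin 2) ℤ L) (Ω : Set GinzburgLandau.Plane)
    (hΩ : IsAddFundamentalDomain L Ω (volume : Measure GinzburgLandau.Plane))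
    (hΩ_area : volume Ω = 1)
    (k Hint : ℝ) (hk : 1 / Real.sqrt 2 ≤ k) (hHint : k ≤ Hint) :
    GinzburgLandau.mE b Ω k Hint = 1 / 4 ∧
      ∀ (u : GinzburgLandau.Plane → ℂ) (a : GinzburgLandau.Plane → GinzburgLandau.Plane),
        ((u, a) ∈ GinzburgLandau.admissible b Ω ∧
            GinzburgLandau.energy Ω k Hint u a = GinzburgLandau.mE b Ω k Hint) ↔
          (u =ᵐ[volume] 0 ∧ a =ᵐ[volume] 0) := by
  obtain ⟨D, hD, hDb⟩ := exists_bounded_fundamentalDomain b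
  have hquarter : (1 / 4 : ENNReal) = ENNReal.ofReal (1 / 4) := by
    rw [ENNReal.ofReal_div_of_pos (by norm_num)]; simp
  have hmin : mE b Ω k Hint = 1 / 4 := by
    refine le_antisymm ?_ (le_iInf₂ fun p hp => ?_)
    · exact (iInf₂_le ((0 : Plane → ℂ), (0 : Plane → Plane))
        (mem_admissible_of_ae_eq_zero b Filter.EventuallyEq.rfl Filter.EventuallyEq.rfl)).trans
        (energy_of_ae_eq_zero hΩ_area k Hint Filter.EventuallyEq.rfl Filter.EventuallyEq.rfl).le
    · refine le_trans ?_
        (ofReal_quarter_add_le_energy b hΩ hΩ_area hD hDb hk hHint hp.1 hp.2).2.2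
      rw [hquarter]
      exact ENNReal.ofReal_le_ofReal
        (le_add_of_nonneg_right (mul_nonneg (by norm_num)
          (MeasureTheory.integral_nonneg fun z => mul_self_nonneg _)))
  refine ⟨hmin, fun u a => ⟨fun ⟨⟨hu, ha⟩, he⟩ => ?_, fun ⟨hu, ha⟩ => ?_⟩⟩
  swap
  · exact ⟨mem_admissible_of_ae_eq_zero b hu ha,
      (energy_of_ae_eq_zero hΩ_area k Hint hu ha).trans hmin.symm⟩
  obtain ⟨pN, iS, hle⟩ := ofReal_quarter_add_le_energy b hΩ hΩ_area hD hDb hk hHint hu ha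
  rw [he, hmin, hquarter, ENNReal.ofReal_le_ofReal_iff (by norm_num)] at hle
  have hnn : 0 ≤ ∫ z in Ω, (inner ℝ (u z) (u z) + mu k Hint * curl a z)
      * (inner ℝ (u z) (u z) + mu k Hint * curl a z) :=
    MeasureTheory.integral_nonneg fun z => mul_self_nonneg _
  have hS : ∀ᵐ z ∂(volume.restrict Ω), inner ℝ (u z) (u z) + mu k Hint * curl a z = 0 := by
    have h0 := (MeasureTheory.integral_eq_zero_iff_of_nonneg (fun z => mul_self_nonneg _) iS).1
      (le_antisymm (by linarith) hnn)
    exact h0.mono fun z hz => mul_self_eq_zero.1 hz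
  -- `|u|² = -μ curl a`, and the right-hand side has mean zero
  have lN := hu.1.l2Loc_inner_self
  have iN : IntegrableOn (fun z => (inner ℝ (u z) (u z) : ℝ)) Ω :=
    pN.integrableOn hΩ hD hDb lN.locallyIntegrable
  have hN : ∫ z in Ω, (inner ℝ (u z) (u z) : ℝ) = 0 := by
    have e : ∀ᵐ z ∂(volume.restrict Ω), (inner ℝ (u z) (u z) : ℝ) = -mu k Hint * curl a z :=
      hS.mono fun z hz => by linarith
    rw [integral_congr_ae e, MeasureTheory.integral_const_mul, ha.setIntegral_curl hΩ hD hDb,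
      mul_zero]
  have hN0 := (integral_eq_zero_iff_of_nonneg (fun z => real_inner_self_nonneg) iN).1 hN
  have hu0 : u =ᵐ[volume] 0 := by
    filter_upwards [pN.ae_eq_zero hΩ hN0] with z hz
    exact inner_self_eq_zero.1 hz
  have hmu : mu k Hint ≠ 0 := by
    have hk0 : 0 < k := lt_of_lt_of_le (by positivity) hk
    have := hk0.trans_le hHint
    rw [mu]; positivity
  have hcurl : curl a =ᵐ[volume] 0 := by
    refine ha.periodicAE_curl.ae_eq_zero hΩ ?_
    filter_upwards [hS, hN0] with z h1 h2
    rw [h2] at h1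
    simpa [hmu] using h1
  exact ⟨hu0, ha.ae_eq_zero hΩ hΩ_area hD hDb hcurl⟩
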